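/- There are $m\ge 1$ identical servers. A server running at speed $s\ge 0$ processes work at rate $s$ and consumes power $P(s)$, where $P:[0,\infty)\to[0,\infty)$ satisfies $P(0)=0$, is differentiable, strictly increasing and strictly convex, and is such that $P(s)>s$ for some $s>0$. Finitely many jobs $0,1,\dots,J-1$, each of size $1$, are labelled in the order of their arrival times $a_0\le a_1\le\dots\le a_{J-1}$, which are otherwise arbitrary. A schedule specifies, for each server $k$ and time $t$, a speed $s_k(t)\ge 0$ and the job (if any) served by $k$; a job is never served before its arrival or by two servers at once, and preemption is allowed. A job is unfinished from its arrival until the work done on it reaches its size. With $n(t)$ the number of unfinished jobs at time $t$, the cost of a schedule is flow time plus energy, $$C=\int n(t)\,dt+\int\sum_{k=1}^m P(s_k(t))\,dt .$$ Let $C_{\mathrm{OPT}}$ be the infimum of $C$ over all (offline) schedules in which each job is assigned to one server and is processed only by that server. Let $\mathcal U$ be the online policy that dispatches the jobs round robin (job $j$ goes to server $j \bmod m$, where servers are numbered $0,\dots,m-1$), serves at each server an unfinished job of that server with the shortest remaining size (ties broken by any rule, so that first come first served is included), never idling while the server has an unfinished job, and runs each server $k$ at speed $s_k(t)=P^{-1}(n_k(t))$,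 where $n_k(t)$ is the number of unfinished jobs assigned to server $k$ at time $t$. **Theorem.** $\mathcal U$ is $2$-competitive: for all such $P$, $m$ and arrival times, a schedule produced by $\mathcal U$ exists, and every such schedule has cost $C_{\mathcal U}\le 2\,C_{\mathrm{OPT}}$. -/

import Mathlib

open MeasureTheory Set
open scoped NNReal ENNReal

namespace SpeedScaling

/-- The standing assumption on a power function `P : ℝ₊ → ℝ₊` (only its values on `[0, ∞)` matter):
`P 0 = 0`, `P` is differentiable, strictly increasing and strictly convex, and
`inf {s > 0 | P s > s} < ∞`, which says that this set is nonempty. -/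
structure IsPowerFunction (P : ℝ → ℝ) : Prop where
  map_zero : P 0 = 0
  differentiableOn : DifferentiableOn ℝ P (Ici 0)
  strictMonoOn : StrictMonoOn P (Ici 0)
  strictConvexOn : StrictConvexOn ℝ (Ici 0) P
  exists_gt : ∃ s : ℝ, 0 < s ∧ s < P s

/-- The inverse `P⁻¹ : [0, ∞) → [0, ∞)` of a power function. -/
noncomputable def powerInv (P : ℝ → ℝ) (y : ℝ) : ℝ :=
  Function.invFunOn P (Ici 0) y

/-- A job sequence: `J` jobs, labelled in the order of their arrival, each with an arrival
(release) time and a positive size. -/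
structure JobSequence (J : ℕ) where
  arrival : Fin J → ℝ
  size : Fin J → ℝ≥0
  arrival_mono : Monotone arrival
  size_pos : ∀ j, 0 < size j

/-- A preemptive schedule of the job sequence `σ` on `m` homogeneous servers. At time `t` the
server `k` runs at speed `speed k t` and serves the job `job k t` (`none` if it serves no job).
A job is never served before its arrival, nor by two servers at the same time. -/
structure Schedule {J : ℕ} (σ : JobSequence J) (m : ℕ) where
  speed : Fin m → ℝ → ℝ≥0
  job : Fin m → ℝ → Option (Fin J)
  measurable_speed : ∀ k, Measurable (speed k)
  measurableSet_job : ∀ k j, MeasurableSet {t | job k t = some j}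
  arrival_le : ∀ k t j, job k t = some j → σ.arrival j ≤ t
  no_splitting : ∀ k k' t j, job k t = some j → job k' t = some j → k = k'

namespace Schedule

variable {J m : ℕ} {σ : JobSequence J}

open scoped Classical in
/-- The rate at which job `j` is being processed at time `t`. -/
noncomputable def rate (S : Schedule σ m) (j : Fin J) (t : ℝ) : ℝ≥0 :=
  ∑ k : Fin m, if S.job k t = some j then S.speed k t else 0

/-- The amount of work completed for job `j` up to time `t`. -/
noncomputable def workDone (S : Schedule σ m) (j : Fin J) (t : ℝ) : ℝ≥0∞ :=
  ∫⁻ u in Iic t, (S.rate j u : ℝ≥0∞)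

/-- The remaining size of job `j` at time `t`. -/
noncomputable def remaining (S : Schedule σ m) (j : Fin J) (t : ℝ) : ℝ≥0∞ :=
  (σ.size j : ℝ≥0∞) - S.workDone j t

/-- Job `j` is unfinished at time `t`: it has arrived but its work is not completed. -/
def Unfinished (S : Schedule σ m) (j : Fin J) (t : ℝ) : Prop :=
  σ.arrival j ≤ t ∧ S.workDone j t < σ.size j

open scoped Classical in
/-- The number `n(t)` of unfinished jobs at time `t`. -/
noncomputable def numUnfinished (S : Schedule σ m) (t : ℝ) : ℕ :=
  (Finset.univ.filter fun j : Fin J => S.Unfinished j t).card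

open scoped Classical in
/-- The number `n_k(t)` of unfinished jobs at time `t` that `route` has assigned to server `k`. -/
noncomputable def numUnfinishedAt (S : Schedule σ m) (route : Fin J → Fin m) (k : Fin m)
    (t : ℝ) : ℕ :=
  (Finset.univ.filter fun j : Fin J => route j = k ∧ S.Unfinished j t).card

/-- Flow time plus energy, `∫ n(t) dt + ∫ ∑ₖ P (sₖ(t)) dt`. -/
noncomputable def cost (P : ℝ → ℝ) (S : Schedule σ m) : ℝ≥0∞ :=
  (∫⁻ t, (S.numUnfinished t : ℝ≥0∞)) + ∫⁻ t, ∑ k : Fin m, ENNReal.ofReal (P (S.speed k t))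

/-- Every job is processed only by the server to which `route` assigns it. -/
def FollowsRoute (S : Schedule σ m) (route : Fin J → Fin m) : Prop :=
  ∀ k t j, S.job k t = some j → route j = k

/-- No migration: every job is assigned to one server, which alone processes it. -/
def IsNonMigratory (S : Schedule σ m) : Prop :=
  ∃ route : Fin J → Fin m, S.FollowsRoute route

/-- Round robin dispatch: the `j`-th job to arrive (counted from `0`) goes to server `j mod m`. -/
def IsRoundRobin (route : Fin J → Fin m) : Prop :=
  ∀ j, (route j : ℕ) = (j : ℕ) % m

/-- At every time, every server that has an unfinished job assigned to it serves one with the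
shortest remaining size among these (with any rule for ties); a server without one serves no job.
For jobs of equal size this covers every order of service without interruption of started jobs,
in particular first come first served. -/
def ServesSRPT (S : Schedule σ m) (route : Fin J → Fin m) : Prop :=
  ∀ k t,
    (∀ j, S.job k t = some j →
      route j = k ∧ S.Unfinished j t ∧
        ∀ i, route i = k → S.Unfinished i t → S.remaining j t ≤ S.remaining i t) ∧
    (S.job k t = none → S.numUnfinishedAt route k t = 0)

/-- `S` is a run of the policy that dispatches the jobs round robin, serves the jobs of each
server by shortest remaining size first, and runs each server `k` at speed `P⁻¹ (n_k(t))`. -/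
def IsRoundRobinPolicy (P : ℝ → ℝ) (S : Schedule σ m) : Prop :=
  ∃ route : Fin J → Fin m, IsRoundRobin route ∧ S.ServesSRPT route ∧
    ∀ k t, (S.speed k t : ℝ) = powerInv P (S.numUnfinishedAt route k t)

end Schedule

/-- The offline optimal cost: the infimum of the cost over all schedules that assign each job to
one of the `m` servers. -/
noncomputable def optCost (P : ℝ → ℝ) {J : ℕ} (σ : JobSequence J) (m : ℕ) : ℝ≥0∞ :=
  ⨅ (S : Schedule σ m) (_ : S.IsNonMigratory), S.cost P

end SpeedScaling

/-! Under the policy the power of a server equals its number of unfinished jobs. Energy therefore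
equals flow time, and the cost is twice the flow time (`cost_eq_of_policy`). It remains to bound the
flow time of the policy by the full cost of an arbitrary non-migratory schedule of finite cost.

That schedule is normalised twice. Cutting the cumulative useful work of each server at integer
levels gives disjoint service intervals, one per job and in order of arrival. Constant speed on each
interval is cheapest by convexity, and at every time at least as many jobs have been completed as
before (`exists_intervals`). Then all starts and all ends are sorted separately and matched in order
(`exists_roundRobin_intervals`). A unit of work in time `d` takes energy `d * P (1/d)`, which is
convex in `d`, so the sorted matching costs no more. At most one interval per server is open at a
time, so the `i`-th end precedes the `(i + m)`-th start and the sorted intervals fit a round robin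
dispatch. Policy and comparison now share their dispatch, and the servers decouple.

On one server (`integral_num_le`), let `D` be the work of the comparison minus that of the policy,
and `n`, `no` their numbers of unfinished jobs. Shortest remaining size on unit jobs leaves at most
one job partially processed, so work and job counts agree up to less than one unit
(`work_add_num_bounds`). For `D > 0` and `i = ⌈D⌉` this gives `i ≤ n ≤ no + i`. The potential is a
function of `D` with slope `P' g`, where `P g = i`. The policy's speed `s` is at least `g`, so for
comparison speed `v` the tangent at `g` gives `P' g * (v - s) ≤ P' g * (v - g) ≤ P v - i ≤ P v + no
- n`. For `D ≤ 0` the slope is zero and `n ≤ no`. The potential starts at zero and stays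
nonnegative, so integration gives `∫ n ≤ ∫ no + ∫ P v`.

A run of the policy exists because completion times under first come first served can be defined
recursively along each server. -/

namespace SpeedScaling

/-! ### Power functions and their inverses -/

namespace IsPowerFunction

variable {P : ℝ → ℝ} (hP : IsPowerFunction P)
include hP

theorem convexOn : ConvexOn ℝ (Ici 0) P := hP.strictConvexOn.convexOn

theorem monotoneOn : MonotoneOn P (Ici 0) := hP.strictMonoOn.monotoneOn

theorem nonneg {s : ℝ} (hs : 0 ≤ s) : 0 ≤ P s := by
  simpa [hP.map_zero] using hP.monotoneOn (self_mem_Ici) hs hs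

theorem differentiableAt {s : ℝ} (hs : 0 < s) : DifferentiableAt ℝ P s :=
  (hP.differentiableOn s hs.le).differentiableAt (Ici_mem_nhds hs)

/-- The graph of a power function lies above its tangents. -/
theorem tangent_le {c s : ℝ} (hc : 0 < c) (hs : 0 ≤ s) : P c + deriv P c * (s - c) ≤ P s := by
  have hd := (hP.differentiableAt hc).hasDerivAt
  rcases lt_trichotomy s c with h | rfl | h
  · have := hP.convexOn.slope_le_of_hasDerivAt hs (mem_Ici.2 hc.le) h hd
    rw [slope_def_field, div_le_iff₀ (by linarith)] at this
    nlinarith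
  · simp
  · have := hP.convexOn.le_slope_of_hasDerivAt (mem_Ici.2 hc.le) hs h hd
    rw [slope_def_field, le_div_iff₀ (by linarith)] at this
    linarith

theorem deriv_nonneg {c : ℝ} (hc : 0 < c) : 0 ≤ deriv P c := by
  have h := hP.tangent_le hc le_rfl
  have h' := hP.nonneg hc.le
  rw [hP.map_zero] at h
  nlinarith

theorem deriv_mono {b c : ℝ} (hb : 0 < b) (hbc : b ≤ c) : deriv P b ≤ deriv P c := by
  rcases hbc.eq_or_lt with rfl | h
  · rfl
  · have h1 := hP.tangent_le hb (hb.le.trans hbc)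
    have h2 := hP.tangent_le (hb.trans h) hb.le
    nlinarith

/-- The tangent at `1` has positive slope, so `P` is unbounded, and the intermediate value theorem
applies. -/
theorem surjOn : SurjOn P (Ici 0) (Ici 0) := by
  intro y hy
  have hP1 : 0 < P 1 := by
    simpa [hP.map_zero] using hP.strictMonoOn self_mem_Ici (mem_Ici.2 zero_le_one) one_pos
  have hd : 0 < deriv P 1 := by
    have := hP.tangent_le one_pos le_rfl
    rw [hP.map_zero] at this
    linarith
  have hb : y ≤ P (1 + y / deriv P 1) := by
    have := hP.tangent_le one_pos (s := 1 + y / deriv P 1)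
      (by have := div_nonneg (mem_Ici.1 hy) hd.le; linarith)
    have e : deriv P 1 * (1 + y / deriv P 1 - 1) = y := by field_simp; ring
    linarith
  have h0 : 0 ≤ 1 + y / deriv P 1 := by have := div_nonneg (mem_Ici.1 hy) hd.le; linarith
  have := intermediate_value_Icc h0 (hP.differentiableOn.continuousOn.mono Icc_subset_Ici_self)
  obtain ⟨x, hx, rfl⟩ := this ⟨by rw [hP.map_zero]; exact hy, hb⟩
  exact ⟨x, hx.1, rfl⟩

theorem powerInv_nonneg {y : ℝ} (hy : 0 ≤ y) : 0 ≤ powerInv P y :=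
  Function.invFunOn_mem (hP.surjOn hy)

theorem map_powerInv {y : ℝ} (hy : 0 ≤ y) : P (powerInv P y) = y :=
  Function.invFunOn_eq (hP.surjOn hy)

theorem powerInv_mono {x y : ℝ} (hx : 0 ≤ x) (hxy : x ≤ y) : powerInv P x ≤ powerInv P y := by
  by_contra! h
  have := hP.strictMonoOn (hP.powerInv_nonneg (hx.trans hxy)) (hP.powerInv_nonneg hx) h
  rw [hP.map_powerInv hx, hP.map_powerInv (hx.trans hxy)] at this
  linarith

theorem powerInv_zero : powerInv P 0 = 0 :=
  hP.strictMonoOn.injOn (hP.powerInv_nonneg le_rfl) self_mem_Ici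
    (by rw [hP.map_powerInv le_rfl, hP.map_zero])

theorem powerInv_pos {y : ℝ} (hy : 0 < y) : 0 < powerInv P y := by
  refine (hP.powerInv_nonneg hy.le).lt_of_ne' fun h => hy.ne' ?_
  rw [← hP.map_powerInv hy.le, h, hP.map_zero]

end IsPowerFunction

/-! ### The energy of a job of unit size served at constant speed -/

/-- The energy for serving one unit of work at constant speed during a time interval of
length `d`. -/
noncomputable def unitEnergy (P : ℝ → ℝ) (d : ℝ) : ℝ := d * P d⁻¹

/-- This is the perspective of `P` with numerator `1`: the reciprocal of a mean of durations is the
mean of the reciprocals weighted by duration. -/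
theorem IsPowerFunction.convexOn_unitEnergy {P : ℝ → ℝ} (hP : IsPowerFunction P) :
    ConvexOn ℝ (Ioi 0) (unitEnergy P) := by
  refine ⟨convex_Ioi 0, fun x hx y hy a b ha hb hab => ?_⟩
  simp only [mem_Ioi, smul_eq_mul, unitEnergy] at *
  have hd : 0 < a * x + b * y := by
    rcases ha.eq_or_lt with rfl | ha
    · have : b = 1 := by linarith
      simpa [this]
    · have := mul_pos ha hx
      have := mul_nonneg hb hy.le
      linarith
  have h := hP.convexOn.2 (mem_Ici.2 (inv_pos.2 hx).le) (mem_Ici.2 (inv_pos.2 hy).le)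
    (show 0 ≤ a * x / (a * x + b * y) by positivity)
    (show 0 ≤ b * y / (a * x + b * y) by positivity) (by field_simp)
  simp only [smul_eq_mul] at h
  have e : a * x / (a * x + b * y) * x⁻¹ + b * y / (a * x + b * y) * y⁻¹ = (a * x + b * y)⁻¹ := by
    field_simp; linarith
  rw [e] at h
  calc (a * x + b * y) * P (a * x + b * y)⁻¹
      ≤ (a * x + b * y) * (a * x / (a * x + b * y) * P x⁻¹ + b * y / (a * x + b * y) * P y⁻¹) := by
        gcongr
    _ = _ := by field_simp

/-- A convex function of the differences gets smaller when an inversion is removed. -/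
theorem _root_.ConvexOn.add_sub_le_of_inversion {h : ℝ → ℝ} {s : Set ℝ} (hh : ConvexOn ℝ s h)
    {x x' y y' : ℝ} (hx : x ≤ x') (hy : y < y') (h1 : y' - x ∈ s) (h2 : y - x' ∈ s) :
    h (y - x) + h (y' - x') ≤ h (y' - x) + h (y - x') := by
  -- `L` is the gap between the longest and the shortest difference. The two middle differences are
  -- convex combinations of these extremes with interchanged weights, so the weights add up to one
  -- of each.
  set L := y' - x - (y - x') with hL
  have hLpos : 0 < L := by simp only [hL]; linarith
  have s1 : (x' - x) / L + (y' - y) / L = 1 := by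
    rw [← add_div, div_eq_one_iff_eq hLpos.ne']; simp only [hL]; ring
  have p1 : 0 ≤ (x' - x) / L := div_nonneg (by linarith) hLpos.le
  have p2 : 0 ≤ (y' - y) / L := div_nonneg (by linarith) hLpos.le
  have e1 := hh.2 h1 h2 p1 p2 s1
  have e2 := hh.2 h1 h2 p2 p1 ((add_comm _ _).trans s1)
  simp only [smul_eq_mul] at e1 e2
  have f1 : (x' - x) / L * (y' - x) + (y' - y) / L * (y - x') = y - x := by
    field_simp; simp only [hL]; ring
  have f2 : (y' - y) / L * (y' - x) + (x' - x) / L * (y - x') = y' - x' := by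
    field_simp; simp only [hL]; ring
  rw [f1] at e1
  rw [f2] at e2
  calc _ ≤ _ := add_le_add e1 e2
    _ = ((x' - x) / L + (y' - y) / L) * (h (y' - x) + h (y - x')) := by ring
    _ = _ := by rw [s1, one_mul]

/-- Matching sorted starting times with sorted end times minimizes the sum of a convex function of
the lengths. -/
theorem sum_sub_sort_le {J : ℕ} {h : ℝ → ℝ} (hh : ConvexOn ℝ (Ioi 0) h) {x y : Fin J → ℝ}
    (hx : Monotone x) (hxy : ∀ j, x j < y j) :
    (∀ j, x j < (y ∘ Tuple.sort y) j) ∧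
      ∑ j, h ((y ∘ Tuple.sort y) j - x j) ≤ ∑ j, h (y j - x j) := by
  -- Positivity of the lengths belongs to the invariant, since convexity is available only there.
  refine Tuple.bubble_sort_induction (f := y)
    (P := fun z => (∀ j, x j < z j) ∧ ∑ j, h (z j - x j) ≤ ∑ j, h (y j - x j))
    ⟨hxy, le_rfl⟩ fun z i j hij hz ⟨h1, h2⟩ => ?_
  have hxij := hx hij.le
  refine ⟨fun k => ?_, le_trans ?_ h2⟩
  · simp only [Function.comp_apply, Equiv.swap_apply_def]
    split_ifs with h3 h4
    · subst h3; exact hxij.trans_lt (h1 j)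
    · subst h4; exact (h1 k).trans hz
    · exact h1 k
  · have hne : j ∈ Finset.univ.erase i := by simp [hij.ne']
    rw [← Finset.add_sum_erase _ _ (Finset.mem_univ i), ← Finset.add_sum_erase _ _ hne,
      ← Finset.add_sum_erase _ (fun j => h (z j - x j)) (Finset.mem_univ i),
      ← Finset.add_sum_erase _ (fun j => h (z j - x j)) hne, ← add_assoc, ← add_assoc]
    refine add_le_add ?_ (Finset.sum_le_sum fun k hk => ?_)
    · simp only [Function.comp_apply, Equiv.swap_apply_left, Equiv.swap_apply_right]
      exact hh.add_sub_le_of_inversion hxij hz (by simp only [mem_Ioi]; linarith [h1 i])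
        (by simp only [mem_Ioi]; linarith [h1 j])
    · simp only [Finset.mem_erase, Finset.mem_univ, and_true] at hk
      simp [Equiv.swap_apply_of_ne_of_ne hk.2 hk.1]

/-! ### The amortized comparison on one server -/

section Potential

variable {P : ℝ → ℝ}

/-- The price of a unit of work when the policy lags `z` behind the offline schedule. -/
noncomputable def lagPrice (P : ℝ → ℝ) (z : ℝ) : ℝ :=
  if z ≤ 0 then 0 else deriv P (powerInv P ⌈z⌉₊)

theorem lagPrice_of_pos {z : ℝ} (hz : 0 < z) : lagPrice P z = deriv P (powerInv P ⌈z⌉₊) :=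
  if_neg hz.not_ge

theorem lagPrice_of_nonpos {z : ℝ} (hz : z ≤ 0) : lagPrice P z = 0 := if_pos hz

theorem powerInv_ceil_pos (hP : IsPowerFunction P) {z : ℝ} (hz : 0 < z) :
    0 < powerInv P ⌈z⌉₊ :=
  hP.powerInv_pos (by exact_mod_cast Nat.ceil_pos.2 hz)

theorem lagPrice_nonneg (hP : IsPowerFunction P) (z : ℝ) : 0 ≤ lagPrice P z := by
  rcases le_or_gt z 0 with h | h
  · exact (lagPrice_of_nonpos h).ge
  · rw [lagPrice_of_pos h]
    exact hP.deriv_nonneg (powerInv_ceil_pos hP h)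

theorem lagPrice_mono (hP : IsPowerFunction P) : Monotone (lagPrice P) := by
  intro y z hyz
  rcases le_or_gt y 0 with h | h
  · rw [lagPrice_of_nonpos h]
    exact lagPrice_nonneg hP z
  · rw [lagPrice_of_pos h, lagPrice_of_pos (h.trans_le hyz)]
    exact hP.deriv_mono (powerInv_ceil_pos hP h)
      (hP.powerInv_mono (Nat.cast_nonneg _) (Nat.cast_le.2 (Nat.ceil_mono hyz)))

/-- The potential of a lag of `z` units of work. -/
noncomputable def lagPotential (P : ℝ → ℝ) (z : ℝ) : ℝ := ∫ u in (0 : ℝ)..z, lagPrice P u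

theorem lagPotential_zero : lagPotential P 0 = 0 := by simp [lagPotential]

theorem lagPotential_nonneg (hP : IsPowerFunction P) (z : ℝ) : 0 ≤ lagPotential P z := by
  rcases le_total 0 z with h | h
  · exact intervalIntegral.integral_nonneg h fun u _ => lagPrice_nonneg hP u
  · rw [lagPotential, intervalIntegral.integral_symm, intervalIntegral.integral_congr
      (g := fun _ => 0) (fun u hu => lagPrice_of_nonpos ?_)]
    · simp
    · rw [uIcc_of_le h] at hu
      exact hu.2

/-- The price is monotone, so its primitive is convex with the price as a subgradient. This replaces
a derivative, which may fail to exist at integer lags where the price can jump. -/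
theorem lagPotential_subgradient (hP : IsPowerFunction P) (y z : ℝ) :
    lagPotential P y + lagPrice P y * (z - y) ≤ lagPotential P z := by
  have hi : ∀ a b, IntervalIntegrable (lagPrice P) volume a b := fun a b =>
    (lagPrice_mono hP).intervalIntegrable
  have e : lagPotential P z - lagPotential P y = ∫ u in y..z, lagPrice P u :=
    intervalIntegral.integral_interval_sub_left (hi _ _) (hi _ _)
  rcases le_total y z with h | h
  · have := intervalIntegral.integral_mono_on h (f := fun _ => lagPrice P y) (by simp) (hi y z)
      fun u hu => lagPrice_mono hP hu.1
    simp only [intervalIntegral.integral_const, smul_eq_mul] at this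
    linarith
  · have := intervalIntegral.integral_mono_on h (g := fun _ => lagPrice P y) (hi z y) (by simp)
      fun u hu => lagPrice_mono hP hu.2
    simp only [intervalIntegral.integral_const, smul_eq_mul] at this
    rw [intervalIntegral.integral_symm] at e
    linarith

theorem abs_lagPotential_sub_le (hP : IsPowerFunction P) {y z B : ℝ} (hy : y ≤ B) (hz : z ≤ B) :
    |lagPotential P y - lagPotential P z| ≤ lagPrice P B * |y - z| := by
  wlog h : z ≤ y generalizing y z
  · rw [abs_sub_comm, abs_sub_comm y]
    exact this hz hy (le_of_not_ge h)
  have h1 := lagPotential_subgradient hP y z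
  have h2 := lagPotential_subgradient hP z y
  have h3 := lagPrice_nonneg hP z
  have h4 := lagPrice_mono hP hy
  rw [abs_of_nonneg (sub_nonneg.2 h), abs_of_nonneg (by nlinarith)]
  nlinarith

/-- The amortized analysis of one server: the policy serves at speed `s = P⁻¹ (n)`, the offline
schedule at speed `v`, and the lag of the policy lies above `n - no - 1` and is at most `n`. -/
theorem integral_num_le (hP : IsPowerFunction P) {a b M : ℝ} (hab : a ≤ b) {s v : ℝ → ℝ}
    {n no : ℝ → ℕ} (hs : Measurable s) (hv : Measurable v)
    (hs0 : ∀ t, 0 ≤ s t) (hv0 : ∀ t, 0 ≤ v t) (hsM : ∀ t, s t ≤ M) (hvM : ∀ t, v t ≤ M)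
    (hn : IntervalIntegrable (fun t => (n t : ℝ)) volume a b)
    (hno : IntervalIntegrable (fun t => (no t : ℝ)) volume a b)
    (hPv : IntervalIntegrable (fun t => P (v t)) volume a b)
    (hsn : ∀ t, s t = powerInv P (n t))
    (hle : ∀ t ∈ Icc a b, (∫ u in a..t, v u) - ∫ u in a..t, s u ≤ n t)
    (hlt : ∀ t ∈ Icc a b, (n t : ℝ) < no t + ((∫ u in a..t, v u) - ∫ u in a..t, s u) + 1) :
    ∫ t in a..b, (n t : ℝ) ≤ (∫ t in a..b, (no t : ℝ)) + ∫ t in a..b, P (v t) := by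
  have hM : 0 ≤ M := (hs0 a).trans (hsM a)
  have hint : ∀ f : ℝ → ℝ, Measurable f → (∀ t, 0 ≤ f t) → (∀ t, f t ≤ M) → ∀ c d,
      IntervalIntegrable f volume c d := fun f hf h0 h1 c d =>
    (intervalIntegrable_const (c := M)).mono_fun hf.aestronglyMeasurable
      (Filter.Eventually.of_forall fun t => by
        simpa [abs_of_nonneg (h0 t), abs_of_nonneg hM] using h1 t)
  have hsi := hint s hs hs0 hsM
  have hvi := hint v hv hv0 hvM
  set D : ℝ → ℝ := fun t => (∫ u in a..t, v u) - ∫ u in a..t, s u with hD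
  have hDD : ∀ c d, D c - D d = ∫ u in d..c, (v u - s u) := fun c d => by
    rw [intervalIntegral.integral_sub (hvi _ _) (hsi _ _),
      ← intervalIntegral.integral_interval_sub_left (hvi a c) (hvi a d),
      ← intervalIntegral.integral_interval_sub_left (hsi a c) (hsi a d)]
    simp only [hD]; ring
  have hDlip : ∀ c d, |D c - D d| ≤ M * |c - d| := fun c d => by
    rw [hDD]
    rw [← Real.norm_eq_abs]
    refine intervalIntegral.norm_integral_le_of_norm_le_const fun u _ => ?_
    rw [Real.norm_eq_abs, abs_le]
    exact ⟨by linarith [hv0 u, hsM u], by linarith [hvM u, hs0 u]⟩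
  have hDa : D a = 0 := by simp [hD]
  have hDB : ∀ c ∈ Icc a b, D c ≤ M * (b - a) := fun c hc => by
    have := (le_abs_self _).trans (hDlip c a)
    rw [hDa, sub_zero, abs_of_nonneg (by linarith [hc.1])] at this
    nlinarith [hc.2]
  set Φ : ℝ → ℝ := fun t => lagPotential P (D t) with hΦ
  set K := lagPrice P (M * (b - a)) * M with hK
  have hK0 : 0 ≤ K := mul_nonneg (lagPrice_nonneg hP _) hM
  have hΦlip : LipschitzOnWith ⟨K, hK0⟩ Φ (uIcc a b) := by
    refine LipschitzOnWith.of_dist_le_mul fun c hc d hd => ?_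
    rw [uIcc_of_le hab] at hc hd
    refine (abs_lagPotential_sub_le hP (hDB c hc) (hDB d hd)).trans ?_
    have := mul_le_mul_of_nonneg_left (hDlip c d) (lagPrice_nonneg hP (M * (b - a)))
    rwa [← mul_assoc] at this
  have hac := hΦlip.absolutelyContinuousOnInterval
  -- The drift inequality: the potential grows no faster than the comparison's cost rate minus `n`.
  have hderiv : ∀ᵐ t, t ∈ Icc a b → deriv Φ t ≤ (no t + P (v t)) - n t := by
    filter_upwards [hac.ae_differentiableAt, (hvi a b).ae_hasDerivAt_integral,
      (hsi a b).ae_hasDerivAt_integral] with t h1 h2 h3 ht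
    have htu : t ∈ uIcc a b := by rwa [uIcc_of_le hab]
    have hDt : HasDerivAt D (v t - s t) t :=
      (h2 htu a left_mem_uIcc).sub (h3 htu a left_mem_uIcc)
    -- A chain rule without differentiability of the potential: by the subgradient inequality this
    -- function is minimal at `t`, so its derivative vanishes and `Φ' = lagPrice P (D t) * D'`.
    have hmin : IsLocalMin (fun u => Φ u - lagPrice P (D t) * D u) t :=
      Filter.Eventually.of_forall fun u => by
        have := lagPotential_subgradient hP (D t) (D u)
        simp only [hΦ]
        linarith
    have hd := hmin.hasDerivAt_eq_zero ((h1 htu).hasDerivAt.sub (hDt.const_mul (lagPrice P (D t))))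
    have hlt' : (n t : ℝ) < no t + D t + 1 := hlt t ht
    have hle' : D t ≤ n t := hle t ht
    rw [sub_eq_zero] at hd
    rw [hd]
    rcases le_or_gt (D t) 0 with h0 | h0
    · rw [lagPrice_of_nonpos h0]
      have : n t ≤ no t := by
        have : (n t : ℝ) < (no t + 1 : ℕ) := by push_cast; linarith
        exact Nat.lt_succ_iff.1 (Nat.cast_lt.1 this)
      have : (n t : ℝ) ≤ no t := by exact_mod_cast this
      have := hP.nonneg (hv0 t)
      linarith
    · rw [lagPrice_of_pos h0]
      have hi : ⌈D t⌉₊ ≤ n t := Nat.ceil_le.2 hle'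
      have hi' : n t ≤ no t + ⌈D t⌉₊ := by
        have : (n t : ℝ) < (no t + ⌈D t⌉₊ + 1 : ℕ) := by
          push_cast; linarith [Nat.le_ceil (D t)]
        exact Nat.lt_succ_iff.1 (Nat.cast_lt.1 this)
      have hi'' : (n t : ℝ) ≤ no t + ⌈D t⌉₊ := by exact_mod_cast hi'
      -- The tangent is taken at the speed whose power is `⌈D t⌉`. The policy runs at least this
      -- fast because `⌈D t⌉ ≤ n t`.
      have hg := powerInv_ceil_pos hP h0
      have ht1 := hP.tangent_le hg (hv0 t)
      rw [hP.map_powerInv (Nat.cast_nonneg _)] at ht1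
      have hsg : powerInv P ⌈D t⌉₊ ≤ s t := by
        rw [hsn]; exact hP.powerInv_mono (Nat.cast_nonneg _) (by exact_mod_cast hi)
      have := hP.deriv_nonneg hg
      nlinarith
  have hftc := hac.integral_deriv_eq_sub
  have hΦa : Φ a = 0 := by simp [hΦ, hDa, lagPotential_zero]
  have hΦb : 0 ≤ Φ b := lagPotential_nonneg hP _
  have hmono := intervalIntegral.integral_mono_ae_restrict hab hac.intervalIntegrable_deriv
    ((hno.add hPv).sub hn) ((ae_restrict_iff' measurableSet_Icc).2 hderiv)
  have e : ∫ t in a..b, ((no t : ℝ) + P (v t) - n t) =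
      ((∫ t in a..b, (no t : ℝ)) + ∫ t in a..b, P (v t)) - ∫ t in a..b, (n t : ℝ) := by
    rw [← intervalIntegral.integral_add hno hPv,
      ← intervalIntegral.integral_sub (hno.add hPv) hn]
  rw [hftc] at hmono
  have := hmono.trans_eq e
  linarith

end Potential

theorem locallyIntegrable_intervalIntegrable {f : ℝ → ℝ} (hf : LocallyIntegrable f) (a b : ℝ) :
    IntervalIntegrable f volume a b :=
  (hf.integrableOn_isCompact isCompact_uIcc).intervalIntegrable

/-! ### The work done by a schedule as a real function -/

namespace Schedule

variable {J m : ℕ} {σ : JobSequence J} (S : Schedule σ m)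

theorem measurable_rate (j : Fin J) : Measurable (S.rate j) := by
  classical
  unfold rate
  refine Finset.measurable_sum _ fun k _ => ?_
  exact Measurable.ite (S.measurableSet_job k j) (S.measurable_speed k) measurable_const

theorem rate_eq_zero_of_lt {j : Fin J} {t : ℝ} (h : t < σ.arrival j) : S.rate j t = 0 :=
  Finset.sum_eq_zero fun k _ => if_neg fun hk => (S.arrival_le k t j hk).not_gt h

open scoped Classical in
theorem FollowsRoute.rate_eq {S : Schedule σ m} {route : Fin J → Fin m} (h : S.FollowsRoute route)
    (j : Fin J) (t : ℝ) :
    S.rate j t = if S.job (route j) t = some j then S.speed (route j) t else 0 :=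
  Finset.sum_eq_single _ (fun k _ hk => if_neg fun hj => hk (h k t j hj).symm) (by simp)

theorem FollowsRoute.rate_le {S : Schedule σ m} {route : Fin J → Fin m} (h : S.FollowsRoute route)
    (j : Fin J) (t : ℝ) : S.rate j t ≤ S.speed (route j) t := by
  rw [h.rate_eq]
  split_ifs
  · rfl
  · exact zero_le

/-- The amount of work completed for job `j` up to time `t`, as a real number. -/
noncomputable def work (j : Fin J) (t : ℝ) : ℝ := (S.workDone j t).toReal

section LocallyIntegrable

variable {S} {j : Fin J} (hj : LocallyIntegrable fun t => (S.rate j t : ℝ))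
include hj

/-- The rate vanishes before the arrival, so any earlier lower limit gives the same integral. Local
integrability keeps the work finite, so that `toReal` loses nothing. -/
theorem workDone_eq {a : ℝ} (ha : a ≤ σ.arrival j) {t : ℝ} (hat : a ≤ t) :
    S.workDone j t = ENNReal.ofReal (∫ u in a..t, (S.rate j u : ℝ)) := by
  have hi : IntegrableOn (fun u => (S.rate j u : ℝ)) (Ioc a t) :=
    (hj.integrableOn_isCompact isCompact_Icc).mono_set Ioc_subset_Icc_self
  rw [intervalIntegral.integral_of_le hat, ofReal_integral_eq_lintegral_ofReal hi
    (Filter.Eventually.of_forall fun u => (S.rate j u).coe_nonneg), workDone,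
    ← Iic_union_Ioc_eq_Iic hat, lintegral_union measurableSet_Ioc (Iic_disjoint_Ioc le_rfl)]
  have : ∫⁻ u in Iic a, (S.rate j u : ℝ≥0∞) = 0 := by
    rw [← setLIntegral_congr (Iio_ae_eq_Iic (a := a)),
      setLIntegral_congr_fun (g := fun _ => 0) measurableSet_Iio fun u hu => ?_]
    · simp
    · simp [S.rate_eq_zero_of_lt (lt_of_lt_of_le hu ha)]
  rw [this, zero_add]
  simp

theorem workDone_ne_top (t : ℝ) : S.workDone j t ≠ ∞ := by
  rcases le_total (σ.arrival j) t with h | h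
  · rw [workDone_eq hj le_rfl h]
    exact ENNReal.ofReal_ne_top
  · rw [workDone_eq hj h le_rfl]
    exact ENNReal.ofReal_ne_top

theorem work_eq {a : ℝ} (ha : a ≤ σ.arrival j) (t : ℝ) :
    S.work j t = ∫ u in a..t, (S.rate j u : ℝ) := by
  rcases le_total a t with h | h
  · rw [work, workDone_eq hj ha h, ENNReal.toReal_ofReal]
    exact intervalIntegral.integral_nonneg h fun u _ => (S.rate j u).coe_nonneg
  · have : ∫ u in t..a, (S.rate j u : ℝ) = 0 := by
      rw [intervalIntegral.integral_of_le h, ← integral_Ico_eq_integral_Ioc,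
        setIntegral_congr_fun (g := fun _ => 0) measurableSet_Ico fun u hu => ?_]
      · simp
      · simp [S.rate_eq_zero_of_lt (lt_of_lt_of_le hu.2 ha)]
    rw [intervalIntegral.integral_symm, this, work, workDone_eq hj (h.trans ha) le_rfl]
    simp

theorem work_sub (s t : ℝ) : S.work j t - S.work j s = ∫ u in s..t, (S.rate j u : ℝ) := by
  rw [work_eq hj le_rfl, work_eq hj le_rfl]
  exact intervalIntegral.integral_interval_sub_left (locallyIntegrable_intervalIntegrable hj _ _)
    (locallyIntegrable_intervalIntegrable hj _ _)

theorem continuous_work : Continuous (S.work j) := by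
  have : S.work j = fun t => ∫ u in (σ.arrival j)..t, (S.rate j u : ℝ) :=
    funext (work_eq hj le_rfl)
  rw [this]
  exact intervalIntegral.continuous_primitive (fun _ _ => locallyIntegrable_intervalIntegrable hj _ _) _

theorem work_mono : Monotone (S.work j) := fun s t hst => by
  rw [← sub_nonneg, work_sub hj]
  exact intervalIntegral.integral_nonneg hst fun u _ => (S.rate j u).coe_nonneg

theorem work_eq_zero_of_le {t : ℝ} (ht : t ≤ σ.arrival j) : S.work j t = 0 := by
  rw [work_eq hj ht, intervalIntegral.integral_same]

theorem workDone_lt_one_iff {t : ℝ} : S.workDone j t < 1 ↔ S.work j t < 1 := by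
  rw [work, ← ENNReal.toReal_one, ENNReal.toReal_lt_toReal (workDone_ne_top hj t) ENNReal.one_ne_top]

theorem work_eq_of_rate_eq_zero {s t : ℝ} (hst : s ≤ t)
    (h : ∀ u ∈ Ioo s t, S.rate j u = 0) : S.work j s = S.work j t := by
  have := work_sub hj s t
  rw [intervalIntegral.integral_of_le hst, integral_Ioc_eq_integral_Ioo,
    setIntegral_congr_fun (g := fun _ => 0) measurableSet_Ioo fun u hu => by simp [h u hu]] at this
  simp only [integral_zero] at this
  linarith

end LocallyIntegrable

theorem work_nonneg (j : Fin J) (t : ℝ) : 0 ≤ S.work j t := ENNReal.toReal_nonneg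

/-! ### Shortest remaining size first -/

section SRPT

variable {S} {i j : Fin J}

/-- Suppose that `i` is not served while `j` is unfinished and has received more work. Then `j`
stays ahead of `i` until it is finished. -/
theorem work_lt_of_work_lt (hi : LocallyIntegrable fun t => (S.rate i t : ℝ))
    (hj : LocallyIntegrable fun t => (S.rate j t : ℝ))
    (h : ∀ t, S.rate i t ≠ 0 → 1 ≤ S.work j t ∨ S.work j t ≤ S.work i t) {s t : ℝ} (hst : s ≤ t)
    (hs : S.work i s < S.work j s) (ht : S.work j t < 1) : S.work i t < S.work j t := by
  by_contra! hle
  have hc : IsCompact {u ∈ Icc s t | S.work j u ≤ S.work i u} :=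
    isCompact_Icc.inter_right (isClosed_le (continuous_work hj) (continuous_work hi))
  obtain ⟨z, ⟨⟨hsz, hzt⟩, hz⟩, hmin⟩ := hc.exists_isLeast ⟨t, ⟨hst, le_rfl⟩, hle⟩
  have : S.work i s = S.work i z := by
    refine work_eq_of_rate_eq_zero hi hsz fun u hu => ?_
    by_contra hne
    rcases h u hne with h1 | h1
    · exact absurd (h1.trans (work_mono hj (hu.2.le.trans hzt))) ht.not_ge
    · exact hu.2.not_ge (hmin ⟨⟨hu.1.le, hu.2.le.trans hzt⟩, h1⟩)
  have := work_mono hj hsz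
  linarith

/-- Two jobs that are never served at once have not received the same positive amount of work at
all times up to now. -/
theorem work_eq_zero_of_eq (hi : LocallyIntegrable fun t => (S.rate i t : ℝ))
    (hj : LocallyIntegrable fun t => (S.rate j t : ℝ))
    (hij : ∀ t, S.rate i t = 0 ∨ S.rate j t = 0) {t : ℝ}
    (h : ∀ s ≤ t, S.work i s = S.work j s) : S.work i t = 0 := by
  rcases le_total t (σ.arrival i) with hle | hle
  · exact work_eq_zero_of_le hi hle
  rw [work_eq hi le_rfl]
  set a := σ.arrival i
  rw [intervalIntegral.integral_of_le hle, integral_Ioc_eq_integral_Ioo]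
  refine setIntegral_eq_zero_of_ae_eq_zero ?_
  filter_upwards [(locallyIntegrable_intervalIntegrable hi a t).ae_hasDerivAt_integral,
    (locallyIntegrable_intervalIntegrable hj a t).ae_hasDerivAt_integral] with u h1 h2 hu
  have hu' : u ∈ uIcc a t := by rw [uIcc_of_le hle]; exact Ioo_subset_Icc_self hu
  have hd := (h1 hu' a left_mem_uIcc).sub (h2 hu' a left_mem_uIcc)
  -- The works coincide near `u`, so almost everywhere the two rates agree; as one of them is zero,
  -- both are.
  have hz : (fun x => (∫ u in a..x, (S.rate i u : ℝ)) - ∫ u in a..x, (S.rate j u : ℝ)) =ᶠ[nhds u]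
      fun _ => 0 := by
    filter_upwards [Iio_mem_nhds hu.2] with x hx
    rw [← work_sub hi, ← work_sub hj, h x hx.le, h a hle, sub_self]
  have := (hd.congr_of_eventuallyEq hz.symm).unique (hasDerivAt_const u (0 : ℝ))
  rcases hij u with h0 | h0
  · simp [h0]
  · rw [h0] at this
    simpa using this

/-- Under service by shortest remaining size, no two jobs of a server are partially processed. -/
theorem work_eq_zero_or_one_le_of_le (hi : LocallyIntegrable fun t => (S.rate i t : ℝ))
    (hj : LocallyIntegrable fun t => (S.rate j t : ℝ))
    (hij : ∀ t, S.rate i t = 0 ∨ S.rate j t = 0)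
    (h1 : ∀ t, S.rate i t ≠ 0 → 1 ≤ S.work j t ∨ S.work j t ≤ S.work i t)
    (h2 : ∀ t, S.rate j t ≠ 0 → 1 ≤ S.work i t ∨ S.work i t ≤ S.work j t) {t : ℝ}
    (hle : S.work j t ≤ S.work i t) : S.work j t = 0 ∨ 1 ≤ S.work i t := by
  by_contra! hcon
  obtain ⟨h0, hlt⟩ := hcon
  have hpos := (S.work_nonneg j t).lt_of_ne' h0
  have hat : σ.arrival j ≤ t := by
    by_contra! hlt'
    exact h0 (work_eq_zero_of_le hj hlt'.le)
  -- Let `z` be the last time at which `i` is not strictly ahead. After `z` job `j` is never served,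
  -- so it already has its positive amount of work at `z`, and by continuity the two works are equal
  -- there.
  have hc : IsCompact {u ∈ Icc (min (σ.arrival j) (σ.arrival i)) t | S.work i u ≤ S.work j u} :=
    isCompact_Icc.inter_right (isClosed_le (continuous_work hi) (continuous_work hj))
  obtain ⟨z, ⟨⟨haz, hzt⟩, hz⟩, hmax⟩ := hc.exists_isGreatest
    ⟨min (σ.arrival j) (σ.arrival i), ⟨le_rfl, (min_le_left _ _).trans hat⟩, by
      rw [work_eq_zero_of_le hi (min_le_right _ _)]; exact S.work_nonneg _ _⟩
  have hzj : S.work j z = S.work j t := by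
    refine work_eq_of_rate_eq_zero hj hzt fun u hu => ?_
    by_contra hne
    rcases h2 u hne with h3 | h3
    · exact absurd (h3.trans (work_mono hi hu.2.le)) hlt.not_ge
    · exact hu.1.not_ge (hmax ⟨⟨haz.trans hu.1.le, hu.2.le⟩, h3⟩)
  have hzij : S.work i z = S.work j z := by
    refine le_antisymm hz ?_
    rcases hzt.eq_or_lt with rfl | hzt'
    · exact hle
    · refine le_of_tendsto_of_tendsto (b := nhdsWithin z (Ioi z))
        ((continuous_work hj).continuousWithinAt) ((continuous_work hi).continuousWithinAt) ?_
      filter_upwards [Ioc_mem_nhdsGT hzt'] with u hu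
      by_contra! h3
      exact hu.1.not_ge (hmax ⟨⟨haz.trans hu.1.le, hu.2⟩, h3.le⟩)
  have hi1 : S.work i z < 1 := (work_mono hi hzt).trans_lt hlt
  -- A lead at any time before `z` would persist to `z`. The works were thus equal throughout, which
  -- forces them to be zero, whatever the tie-breaking.
  have := work_eq_zero_of_eq hi hj hij (t := z) fun s hs => by
    rcases lt_trichotomy (S.work i s) (S.work j s) with h3 | h3 | h3
    · exact absurd hzij (work_lt_of_work_lt hi hj h1 hs h3 (hzij ▸ hi1)).ne
    · exact h3
    · exact absurd hzij (work_lt_of_work_lt hj hi h2 hs h3 hi1).ne'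
  linarith

end SRPT

end Schedule

theorem locallyIntegrable_of_le {f : ℝ → ℝ≥0} (hf : Measurable f) {M : ℝ} (hM : ∀ t, f t ≤ M) :
    LocallyIntegrable fun t => (f t : ℝ) :=
  (locallyIntegrable_const M).mono hf.coe_nnreal_real.aestronglyMeasurable
    (Filter.Eventually.of_forall fun t => by
      rw [Real.norm_of_nonneg (f t).coe_nonneg, Real.norm_eq_abs]
      exact (hM t).trans (le_abs_self M))

namespace Schedule

variable {J m : ℕ} {σ : JobSequence J} (S : Schedule σ m)

theorem monotone_workDone (j : Fin J) : Monotone (S.workDone j) := fun _ _ h =>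
  lintegral_mono_set (Iic_subset_Iic.2 h)

theorem measurableSet_unfinished (j : Fin J) : MeasurableSet {t | S.Unfinished j t} :=
  measurableSet_Ici.inter ((S.monotone_workDone j).measurable measurableSet_Iio)

theorem measurable_numUnfinishedAt (route : Fin J → Fin m) (k : Fin m) :
    Measurable (S.numUnfinishedAt route k) := by
  classical
  have : S.numUnfinishedAt route k =
      fun t => ∑ j, if route j = k ∧ S.Unfinished j t then 1 else 0 := by
    funext t
    rw [numUnfinishedAt, Finset.card_filter]
  rw [this]
  refine Finset.measurable_sum _ fun j _ => Measurable.ite ?_ measurable_const measurable_const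
  exact (MeasurableSet.const _).inter (S.measurableSet_unfinished j)

theorem numUnfinishedAt_le (route : Fin J → Fin m) (k : Fin m) (t : ℝ) :
    S.numUnfinishedAt route k t ≤ J := by
  classical
  exact (Finset.card_filter_le _ _).trans (by simp)

theorem sum_numUnfinishedAt (route : Fin J → Fin m) (t : ℝ) :
    ∑ k, S.numUnfinishedAt route k t = S.numUnfinished t := by
  classical
  rw [numUnfinished, Finset.card_eq_sum_card_fiberwise (f := route) (t := Finset.univ) (by simp)]
  refine Finset.sum_congr rfl fun k _ => ?_
  rw [numUnfinishedAt, Finset.filter_filter]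
  congr 1
  ext j
  simp [and_comm]

theorem unfinished_iff_of_unit (hunit : ∀ j, σ.size j = 1) {j : Fin J}
    (hj : LocallyIntegrable fun t => (S.rate j t : ℝ)) {t : ℝ} :
    S.Unfinished j t ↔ σ.arrival j ≤ t ∧ S.work j t < 1 := by
  rw [Unfinished, hunit, ENNReal.coe_one, workDone_lt_one_iff hj]

/-! ### Balance of work and job counts under the policy -/

section Policy

variable {S} {P : ℝ → ℝ} (hP : IsPowerFunction P) (hunit : ∀ j, σ.size j = 1)
  {route : Fin J → Fin m} (hS : S.ServesSRPT route)
  (hspeed : ∀ k t, (S.speed k t : ℝ) = powerInv P (S.numUnfinishedAt route k t))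

theorem ServesSRPT.followsRoute (hS : S.ServesSRPT route) : S.FollowsRoute route :=
  fun k t j h => ((hS k t).1 j h).1

include hP hspeed in
theorem speed_le_of_policy (k : Fin m) (t : ℝ) : (S.speed k t : ℝ) ≤ powerInv P J := by
  rw [hspeed]
  exact hP.powerInv_mono (Nat.cast_nonneg _) (Nat.cast_le.2 (S.numUnfinishedAt_le route k t))

include hP hS hspeed in
theorem locallyIntegrable_rate_of_policy (j : Fin J) :
    LocallyIntegrable fun t => (S.rate j t : ℝ) :=
  locallyIntegrable_of_le (S.measurable_rate j) (M := powerInv P J) fun t =>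
    (NNReal.coe_le_coe.2 (hS.followsRoute.rate_le j t)).trans
      (speed_le_of_policy hP hspeed (route j) t)

-- No speed is wasted: a server that serves no job has no unfinished job, hence runs at speed
-- `powerInv P 0 = 0`.
include hP hS hspeed in
open scoped Classical in
theorem speed_eq_sum_rate_of_policy (k : Fin m) (t : ℝ) :
    S.speed k t = ∑ j with route j = k, S.rate j t := by
  have hr := hS.followsRoute
  rcases hjob : S.job k t with _ | j
  · have h0 := (hS k t).2 hjob
    have : S.speed k t = 0 := by
      rw [← NNReal.coe_eq_zero, hspeed, h0, Nat.cast_zero, hP.powerInv_zero]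
    rw [this, Finset.sum_eq_zero fun j hj => ?_]
    rw [hr.rate_eq, if_neg]
    rw [(Finset.mem_filter.1 hj).2, hjob]
    simp
  · have hj := hr k t j hjob
    rw [Finset.sum_eq_single_of_mem j (by simp [hj]) fun i hi hij => ?_]
    · rw [hr.rate_eq, hj, if_pos hjob]
    · rw [hr.rate_eq, if_neg]
      rw [(Finset.mem_filter.1 hi).2, hjob]
      simpa using hij.symm

include hP hS hspeed hunit in
/-- The work done by a server is the number of its finished jobs, up to less than one unit. -/
theorem work_add_num_bounds (k : Fin m) {a : ℝ} (ha : ∀ j, a < σ.arrival j) (t : ℝ) :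
    ((Finset.univ.filter fun j => route j = k ∧ σ.arrival j ≤ t).card : ℝ) ≤
        (∫ u in a..t, (S.speed k u : ℝ)) + S.numUnfinishedAt route k t ∧
      (∫ u in a..t, (S.speed k u : ℝ)) + S.numUnfinishedAt route k t <
        (Finset.univ.filter fun j => route j = k ∧ σ.arrival j ≤ t).card + 1 := by
  classical
  have hli := locallyIntegrable_rate_of_policy hP hS hspeed
  have hr := hS.followsRoute
  have hW : ∫ u in a..t, (S.speed k u : ℝ) = ∑ j with route j = k, S.work j t := by
    simp_rw [speed_eq_sum_rate_of_policy hP hS hspeed, NNReal.coe_sum]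
    rw [intervalIntegral.integral_finsetSum fun j _ =>
      locallyIntegrable_intervalIntegrable (hli j) a t]
    exact Finset.sum_congr rfl fun j _ => (work_eq (hli j) (ha j).le t).symm
  have hN : (S.numUnfinishedAt route k t : ℝ) =
      ∑ j with route j = k, if S.Unfinished j t then (1 : ℝ) else 0 := by
    rw [numUnfinishedAt, Finset.sum_boole, Finset.filter_filter]
  have hA : ((Finset.univ.filter fun j => route j = k ∧ σ.arrival j ≤ t).card : ℝ) =
      ∑ j with route j = k, if σ.arrival j ≤ t then (1 : ℝ) else 0 := by
    rw [Finset.sum_boole, Finset.filter_filter]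
  have hu : ∀ j, S.Unfinished j t ↔ σ.arrival j ≤ t ∧ S.work j t < 1 := fun j =>
    S.unfinished_iff_of_unit hunit (hli j)
  have hserve : ∀ j s, S.rate j s ≠ 0 → S.job (route j) s = some j := fun j s h => by
    by_contra hne
    exact h (by rw [hr.rate_eq, if_neg hne])
  -- Only unfinished jobs are served, so work stops once it reaches `1`.
  have hle1 : ∀ j, S.work j t ≤ 1 := fun j => by
    by_contra! hlt
    have h0 : S.work j (min t (σ.arrival j)) = 0 := work_eq_zero_of_le (hli j) (min_le_right _ _)
    obtain ⟨s, hs, hs1⟩ := intermediate_value_Icc (min_le_left t (σ.arrival j))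
      (continuous_work (hli j)).continuousOn (show (1 : ℝ) ∈ Icc _ _ by
        rw [h0]; exact ⟨zero_le_one, hlt.le⟩)
    have := work_eq_of_rate_eq_zero (hli j) hs.2 fun u hu => by
      by_contra hne
      have h1 := (((hS _ u).1 j (hserve j u hne)).2.1)
      rw [S.unfinished_iff_of_unit hunit (hli j)] at h1
      have := work_mono (hli j) hu.1.le
      linarith [h1.2]
    linarith
  have hSR : ∀ i j, route i = k → route j = k → ∀ s, S.rate i s ≠ 0 →
      1 ≤ S.work j s ∨ S.work j s ≤ S.work i s := fun i j hi hj s hne => by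
    by_cases hjs : S.Unfinished j s
    · right
      have h1 := ((hS _ s).1 i (hserve i s hne))
      have h2 := h1.2.2 j (by rw [hi, hj]) hjs
      have h3 := h1.2.1.2
      have h4 := hjs.2
      simp only [remaining, hunit, ENNReal.coe_one] at h2 h3 h4
      exact ENNReal.toReal_mono (workDone_ne_top (hli i) s)
        ((ENNReal.sub_le_sub_iff_left h4.le ENNReal.one_ne_top).1 h2)
    · rw [S.unfinished_iff_of_unit hunit (hli j), not_and_or, not_le, not_lt] at hjs
      rcases hjs with h1 | h1
      · right
        rw [work_eq_zero_of_le (hli j) h1.le]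
        exact S.work_nonneg _ _
      · exact Or.inl h1
  have hex : ∀ i j, route i = k → route j = k → i ≠ j → ∀ s, S.rate i s = 0 ∨ S.rate j s = 0 :=
    fun i j hi hj hij s => by
      by_contra! h
      have h1 := hserve i s h.1
      have h2 := hserve j s h.2
      rw [hi] at h1
      rw [hj, h1] at h2
      exact hij (Option.some.inj h2)
  have hterm : ∀ j, (S.work j t = 0 ∨ 1 ≤ S.work j t) →
      S.work j t + (if S.Unfinished j t then (1 : ℝ) else 0) ≤
        if σ.arrival j ≤ t then (1 : ℝ) else 0 := fun j h => by
    by_cases hat : σ.arrival j ≤ t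
    · rcases h with h | h
      · rw [if_pos ((hu j).2 ⟨hat, by rw [h]; exact one_pos⟩), if_pos hat, h, zero_add]
      · rw [if_neg (fun h' => h.not_gt ((hu j).1 h').2), if_pos hat, add_zero]
        exact hle1 j
    · rw [if_neg hat, if_neg (fun h' => hat h'.1), work_eq_zero_of_le (hli j) (not_le.1 hat).le,
        add_zero]
  rw [hW, hN, hA, ← Finset.sum_add_distrib]
  constructor
  · refine Finset.sum_le_sum fun j _ => ?_
    have := S.work_nonneg j t
    by_cases hat : σ.arrival j ≤ t
    · by_cases h1 : S.work j t < 1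
      · rw [if_pos hat, if_pos ((hu j).2 ⟨hat, h1⟩)]
        linarith
      · rw [if_pos hat, if_neg (fun h => h1 ((hu j).1 h).2)]
        linarith
    · rw [if_neg hat]
      split_ifs <;> linarith
  -- Only a partially processed job counts for more than its arrival, by its work, which is less
  -- than `1`. There is at most one such job, hence the strict bound.
  · by_cases hpart : ∃ j, route j = k ∧ 0 < S.work j t ∧ S.work j t < 1
    · obtain ⟨j, hjk, hj0, hj1⟩ := hpart
      have hmem : j ∈ Finset.univ.filter fun j => route j = k := by simp [hjk]
      rw [← Finset.add_sum_erase _ _ hmem,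
        ← Finset.add_sum_erase _ (fun j => if σ.arrival j ≤ t then (1 : ℝ) else 0) hmem]
      have hat : σ.arrival j ≤ t := by
        by_contra! h
        exact hj0.ne' (work_eq_zero_of_le (hli j) h.le)
      rw [if_pos hat, if_pos ((hu j).2 ⟨hat, hj1⟩)]
      have := Finset.sum_le_sum (s := (Finset.univ.filter fun j => route j = k).erase j)
        (f := fun j => S.work j t + (if S.Unfinished j t then (1 : ℝ) else 0))
        (g := fun j => if σ.arrival j ≤ t then (1 : ℝ) else 0) fun i hi => by
          simp only [Finset.mem_erase, Finset.mem_filter, Finset.mem_univ, true_and] at hi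
          refine hterm i ?_
          rcases le_total (S.work i t) (S.work j t) with h | h
          · exact Or.inl ((work_eq_zero_or_one_le_of_le (hli j) (hli i)
              (hex j i hjk hi.2 hi.1.symm) (hSR j i hjk hi.2) (hSR i j hi.2 hjk) h).resolve_right
              hj1.not_ge)
          · exact Or.inr ((work_eq_zero_or_one_le_of_le (hli i) (hli j)
              (hex i j hi.2 hjk hi.1) (hSR i j hi.2 hjk) (hSR j i hjk hi.2) h).resolve_left
              hj0.ne')
      linarith
    · push Not at hpart
      refine (Finset.sum_le_sum fun j hj => hterm j ?_).trans_lt (lt_add_one _)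
      rcases (S.work_nonneg j t).eq_or_lt with h | h
      · exact Or.inl h.symm
      · exact Or.inr (hpart j (Finset.mem_filter.1 hj).2 h)

end Policy

end Schedule

/-! ### Serving jobs one after the other at constant speeds -/

/-- The speed profile that serves one unit of work in each of the intervals `[x j, y j)`. -/
noncomputable def intervalSpeed {ι : Type*} (K : Finset ι) (x y : ι → ℝ) (t : ℝ) : ℝ :=
  ∑ j ∈ K, (Ico (x j) (y j)).indicator (fun _ => (y j - x j)⁻¹) t

theorem setIntegral_indicator_Ico_nonneg {x y c : ℝ} (s : Set ℝ) (hc : 0 ≤ c) :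
    0 ≤ ∫ u in s, (Ico x y).indicator (fun _ => c) u :=
  integral_nonneg fun _ => indicator_nonneg (fun _ _ => hc) _

theorem integrable_indicator_Ico (x y c : ℝ) :
    Integrable ((Ico x y).indicator fun _ => c) :=
  (integrable_indicator_iff measurableSet_Ico).2 (integrableOn_const (by simp) (by simp))

theorem integral_indicator_Ico_le {x y c : ℝ} (s : Set ℝ) (hxy : x ≤ y) (hc : 0 ≤ c) :
    ∫ u in s, (Ico x y).indicator (fun _ => c) u ≤ (y - x) * c := by
  refine (setIntegral_le_integral (integrable_indicator_Ico x y c)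
    (Filter.Eventually.of_forall fun _ => indicator_nonneg (fun _ _ => hc) _)).trans_eq ?_
  rw [integral_indicator measurableSet_Ico, setIntegral_const, smul_eq_mul,
    Real.volume_real_Ico_of_le hxy]

section IntervalSpeed

variable {ι : Type*} {K : Finset ι} {x y : ι → ℝ}

theorem measurable_intervalSpeed : Measurable (intervalSpeed K x y) :=
  Finset.measurable_sum _ fun _ _ => measurable_const.indicator measurableSet_Ico

/-- The power of an interval schedule whose intervals are disjoint. -/
theorem map_intervalSpeed {P : ℝ → ℝ} (hP0 : P 0 = 0)
    (hdisj : ∀ i ∈ K, ∀ j ∈ K, i ≠ j → y i ≤ x j ∨ y j ≤ x i) (t : ℝ) :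
    P (intervalSpeed K x y t) =
      ∑ j ∈ K, (Ico (x j) (y j)).indicator (fun _ => P (y j - x j)⁻¹) t := by
  by_cases h : ∃ i ∈ K, t ∈ Ico (x i) (y i)
  · obtain ⟨i, hi, hti⟩ := h
    have hother : ∀ j ∈ K, j ≠ i → t ∉ Ico (x j) (y j) := fun j hj hji htj => by
      rcases hdisj i hi j hj hji.symm with h | h
      · exact (hti.2.trans_le h).not_ge htj.1
      · exact (htj.2.trans_le h).not_ge hti.1
    rw [intervalSpeed, Finset.sum_eq_single_of_mem i hi fun j hj hji =>
        indicator_of_notMem (hother j hj hji) _,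
      Finset.sum_eq_single_of_mem i hi fun j hj hji => indicator_of_notMem (hother j hj hji) _,
      indicator_of_mem hti, indicator_of_mem hti]
  · push Not at h
    rw [intervalSpeed, Finset.sum_eq_zero fun j hj => indicator_of_notMem (h j hj) _,
      Finset.sum_eq_zero fun j hj => indicator_of_notMem (h j hj) _, hP0]

variable (hxy : ∀ j ∈ K, x j < y j)
include hxy

theorem intervalSpeed_nonneg (t : ℝ) : 0 ≤ intervalSpeed K x y t :=
  Finset.sum_nonneg fun j hj => indicator_nonneg
    (fun _ _ => inv_nonneg.2 (sub_nonneg.2 (hxy j hj).le)) t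

theorem intervalSpeed_le (t : ℝ) : intervalSpeed K x y t ≤ ∑ j ∈ K, (y j - x j)⁻¹ :=
  Finset.sum_le_sum fun j hj => indicator_le_self' (s := Ico (x j) (y j))
    (fun _ _ => inv_nonneg.2 (sub_nonneg.2 (hxy j hj).le)) t

/-- An interval that has ended contributes exactly one unit, one that has not begun contributes
nothing, and one in progress lies in between. -/
theorem integral_intervalSpeed_bounds {a : ℝ} (ha : ∀ j ∈ K, a < x j) {t : ℝ} (hat : a ≤ t) :
    ((K.filter fun j => y j ≤ t).card : ℝ) ≤ ∫ u in a..t, intervalSpeed K x y u ∧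
      ∫ u in a..t, intervalSpeed K x y u ≤ (K.filter fun j => x j ≤ t).card := by
  have e : ∫ u in a..t, intervalSpeed K x y u =
      ∑ j ∈ K, ∫ u in Ioc a t, (Ico (x j) (y j)).indicator (fun _ => (y j - x j)⁻¹) u := by
    rw [intervalIntegral.integral_of_le hat]
    exact integral_finsetSum _ fun j _ => (integrable_indicator_Ico _ _ _).integrableOn
  rw [e, Finset.card_filter, Finset.card_filter, Nat.cast_sum, Nat.cast_sum]
  constructor
  · refine Finset.sum_le_sum fun j hj => ?_
    have hc : 0 ≤ (y j - x j)⁻¹ := inv_nonneg.2 (sub_nonneg.2 (hxy j hj).le)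
    split_ifs with h
    · have hsub : Ioc a t ∩ Ico (x j) (y j) = Ico (x j) (y j) :=
        inter_eq_right.2 fun u hu => ⟨(ha j hj).trans_le hu.1, hu.2.le.trans h⟩
      rw [setIntegral_indicator measurableSet_Ico, hsub, setIntegral_const, smul_eq_mul,
        Real.volume_real_Ico_of_le (hxy j hj).le,
        mul_inv_cancel₀ (sub_pos.2 (hxy j hj)).ne', Nat.cast_one]
    · simpa using setIntegral_indicator_Ico_nonneg _ hc
  · refine Finset.sum_le_sum fun j hj => ?_
    have hc : 0 ≤ (y j - x j)⁻¹ := inv_nonneg.2 (sub_nonneg.2 (hxy j hj).le)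
    split_ifs with h
    · refine (integral_indicator_Ico_le _ (hxy j hj).le hc).trans_eq ?_
      rw [mul_inv_cancel₀ (sub_pos.2 (hxy j hj)).ne', Nat.cast_one]
    · rw [setIntegral_congr_fun (g := fun _ => 0) measurableSet_Ioc fun u hu => ?_]
      · simp
      · exact indicator_of_notMem (fun hu' => h (hu'.1.trans hu.2)) _

end IntervalSpeed

/-- Reduces to bounded horizons, so that the flow time of the policy need not be known to be finite
beforehand. -/
theorem lintegral_le_of_forall_Ioc {f : ℝ → ℝ≥0∞} {a : ℝ} (ha : ∀ t ≤ a, f t = 0) {C : ℝ≥0∞}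
    (h : ∀ b, a ≤ b → ∫⁻ t in Ioc a b, f t ≤ C) : ∫⁻ t, f t ≤ C := by
  have e : ∫⁻ t, f t = ∫⁻ t in ⋃ N : ℕ, Ioc a (a + N), f t := by
    rw [← lintegral_indicator (MeasurableSet.iUnion fun _ => measurableSet_Ioc)]
    refine lintegral_congr fun t => ?_
    rcases le_or_gt t a with ht | ht
    · rw [ha t ht]
      exact (indicator_apply_eq_zero.2 fun _ => ha t ht).symm
    · rw [indicator_of_mem]
      obtain ⟨N, hN⟩ := exists_nat_ge (t - a)
      exact mem_iUnion.2 ⟨N, ht, by linarith⟩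
  rw [e, setLIntegral_iUnion_of_directed]
  · exact iSup_le fun N => h _ (by simp)
  · exact directed_of_isDirected_le fun M N hMN => Ioc_subset_Ioc_right (by
      have : (M : ℝ) ≤ N := by exact_mod_cast hMN
      linarith)

/-! ### Comparison of the policy with interval schedules on one server -/

namespace Schedule

variable {J m : ℕ} {σ : JobSequence J} {S : Schedule σ m} {P : ℝ → ℝ}

open scoped Classical in
/-- On each server, the flow time of the policy is at most the flow time plus energy of serving the
same jobs one after the other at constant speeds. -/
theorem lintegral_numUnfinishedAt_le (hP : IsPowerFunction P) (hunit : ∀ j, σ.size j = 1)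
    {route : Fin J → Fin m} (hS : S.ServesSRPT route)
    (hspeed : ∀ k t, (S.speed k t : ℝ) = powerInv P (S.numUnfinishedAt route k t))
    {x y : Fin J → ℝ} (hx : ∀ j, σ.arrival j ≤ x j) (hxy : ∀ j, x j < y j)
    (hdisj : ∀ i j, route i = route j → i < j → y i ≤ x j) (k : Fin m) :
    ∫⁻ t, (S.numUnfinishedAt route k t : ℝ≥0∞) ≤
      (∫⁻ t, ((Finset.univ.filter fun j => route j = k ∧ σ.arrival j ≤ t ∧ t < y j).card : ℝ≥0∞)) +
        ∑ j with route j = k, ENNReal.ofReal (unitEnergy P (y j - x j)) := by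
  obtain ⟨a, ha⟩ : ∃ a, ∀ j, a < σ.arrival j := by
    obtain ⟨b, hb⟩ := (finite_range σ.arrival).bddBelow
    exact ⟨b - 1, fun j => by linarith [hb (mem_range_self j)]⟩
  set K := Finset.univ.filter fun j => route j = k with hK
  set v := intervalSpeed K x y with hv
  set no : ℝ → ℕ := fun t =>
    (Finset.univ.filter fun j => route j = k ∧ σ.arrival j ≤ t ∧ t < y j).card with hno
  have hxyK : ∀ j ∈ K, x j < y j := fun j _ => hxy j
  have hnomeas : Measurable no := by
    have : no = fun t => ∑ j, if route j = k ∧ σ.arrival j ≤ t ∧ t < y j then 1 else 0 := by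
      funext t
      simp only [hno, Finset.card_filter]
    rw [this]
    refine Finset.measurable_sum _ fun j _ => Measurable.ite ?_ measurable_const measurable_const
    exact (MeasurableSet.const _).inter (measurableSet_Ici.inter measurableSet_Iio)
  have hint : ∀ f : ℝ → ℕ, Measurable f → (∀ t, f t ≤ J) → ∀ b,
      IntervalIntegrable (fun t => (f t : ℝ)) volume a b := fun f hf hfJ b =>
    (intervalIntegrable_const (c := (J : ℝ))).mono_fun
      (measurable_from_nat.comp hf : Measurable fun t => (f t : ℝ)).aestronglyMeasurable
      (Filter.Eventually.of_forall fun t => by simpa using hfJ t)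
  have hP0 : ∀ j, 0 ≤ P (y j - x j)⁻¹ := fun j =>
    hP.nonneg (inv_nonneg.2 (sub_nonneg.2 (hxy j).le))
  have hPv : (fun t => P (v t)) =
      fun t => ∑ j ∈ K, (Ico (x j) (y j)).indicator (fun _ => P (y j - x j)⁻¹) t :=
    funext <| map_intervalSpeed hP.map_zero fun i hi j hj hij => by
      have hr : route i = route j := by
        rw [(Finset.mem_filter.1 hi).2, (Finset.mem_filter.1 hj).2]
      rcases lt_or_gt_of_ne hij with h | h
      · exact Or.inl (hdisj i j hr h)
      · exact Or.inr (hdisj j i hr.symm h)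
  have hPvint : Integrable fun t => P (v t) := by
    rw [hPv]
    exact integrable_finsetSum _ fun j _ => integrable_indicator_Ico _ _ _
  refine lintegral_le_of_forall_Ioc (a := a) (fun t ht => ?_) fun b hab => ?_
  · rw [Nat.cast_eq_zero]
    exact Finset.card_eq_zero.2 (Finset.filter_eq_empty_iff.2 fun j _ h =>
      (h.2.1.trans ht).not_gt (ha j))
  have hnJ := S.numUnfinishedAt_le route k
  have hnoJ : ∀ t, no t ≤ J := fun t => (Finset.card_filter_le _ _).trans (by simp)
  have hsb := speed_le_of_policy hP hspeed k
  have hs0 : 0 ≤ powerInv P J := hP.powerInv_nonneg (Nat.cast_nonneg _)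
  have hv0 := intervalSpeed_nonneg hxyK
  have hvb := intervalSpeed_le hxyK
  have key := integral_num_le hP (M := powerInv P J + ∑ j ∈ K, (y j - x j)⁻¹) hab
    (S.measurable_speed k).coe_nnreal_real measurable_intervalSpeed
    (fun t => (S.speed k t).coe_nonneg) hv0
    (fun t => by linarith [hsb t, hv0 t, hvb t]) (fun t => by linarith [hvb t])
    (hint _ (S.measurable_numUnfinishedAt route k) hnJ b) (hint _ hnomeas hnoJ b)
    hPvint.intervalIntegrable (hspeed k)
    -- Upper bound on the lag: the comparison works only on arrived jobs, and arrivals are at most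
    -- policy work plus `n`.
    (fun t ht => by
      have h1 := (work_add_num_bounds hP hunit hS hspeed k ha t).1
      have h2 := (integral_intervalSpeed_bounds hxyK (fun j _ => (ha j).trans_le (hx j)) ht.1).2
      have h3 : ((K.filter fun j => x j ≤ t).card : ℝ) ≤
          (Finset.univ.filter fun j => route j = k ∧ σ.arrival j ≤ t).card := by
        rw [hK, Finset.filter_filter]
        exact_mod_cast Finset.card_le_card fun j hj => by
          simp only [Finset.mem_filter, Finset.mem_univ, true_and] at hj ⊢
          exact ⟨hj.1, (hx j).trans hj.2⟩
      linarith)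
    -- Lower bound on the lag: arrivals are at most `no` plus the comparison's completions, which
    -- its work covers, while policy work plus `n` stays below arrivals plus one.
    (fun t ht => by
      have h1 := (work_add_num_bounds hP hunit hS hspeed k ha t).2
      have h2 := (integral_intervalSpeed_bounds hxyK (fun j _ => (ha j).trans_le (hx j)) ht.1).1
      have h3 : ((Finset.univ.filter fun j => route j = k ∧ σ.arrival j ≤ t).card : ℝ) ≤
          no t + (K.filter fun j => y j ≤ t).card := by
        rw [hK, Finset.filter_filter, ← Nat.cast_add, Nat.cast_le]
        refine le_trans (Finset.card_le_card fun j hj => ?_) (Finset.card_union_le _ _)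
        simp only [Finset.mem_union, Finset.mem_filter, Finset.mem_univ, true_and] at hj ⊢
        rcases lt_or_ge t (y j) with h | h
        · exact Or.inl ⟨hj.1, hj.2, h⟩
        · exact Or.inr ⟨hj.1, h⟩
      linarith)
  have hcast : ∀ f : ℝ → ℕ, Measurable f → (∀ t, f t ≤ J) →
      ∫⁻ t in Ioc a b, (f t : ℝ≥0∞) = ENNReal.ofReal (∫ t in a..b, (f t : ℝ)) :=
    fun f hf hfJ => by
      rw [intervalIntegral.integral_of_le hab, ofReal_integral_eq_lintegral_ofReal
        ((intervalIntegrable_iff_integrableOn_Ioc_of_le hab).1 (hint f hf hfJ b))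
        (Filter.Eventually.of_forall fun t => Nat.cast_nonneg _)]
      simp
  rw [hcast _ (S.measurable_numUnfinishedAt route k) hnJ]
  refine (ENNReal.ofReal_le_ofReal key).trans (ENNReal.ofReal_add_le.trans (add_le_add ?_ ?_))
  · rw [← hcast no hnomeas hnoJ]
    exact setLIntegral_le_lintegral _ _
  · rw [← ENNReal.ofReal_sum_of_nonneg (f := fun j => unitEnergy P (y j - x j)) fun j _ =>
      mul_nonneg (sub_nonneg.2 (hxy j).le) (hP0 j)]
    refine ENNReal.ofReal_le_ofReal ?_
    change ∫ t in a..b, P (v t) ≤ _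
    rw [hPv, intervalIntegral.integral_of_le hab,
      integral_finsetSum _ fun j _ => (integrable_indicator_Ico _ _ _).integrableOn]
    exact Finset.sum_le_sum fun j _ => integral_indicator_Ico_le _ (hxy j).le (hP0 j)

end Schedule

/-! ### Rearranging an offline schedule: first come first served on each server -/

theorem exists_last_eq {f : ℝ → ℝ} (hf : Continuous f) (hmono : Monotone f) {a b r : ℝ}
    (ha : f a ≤ r) (hb : r < f b) : ∃ x, f x = r ∧ ∀ t, x < t → r < f t := by
  obtain ⟨c, hc⟩ := mem_range_of_exists_le_of_exists_ge hf ⟨a, ha⟩ ⟨b, hb.le⟩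
  have hbdd : BddAbove {t | f t ≤ r} := ⟨b, fun t (ht : f t ≤ r) => by
    by_contra! h
    exact (hb.trans_le (hmono h.le)).not_ge ht⟩
  have hmem := (isClosed_le hf continuous_const).csSup_mem ⟨c, hc.le⟩ hbdd
  refine ⟨_, le_antisymm hmem ?_, fun t ht => ?_⟩
  · exact hc.ge.trans (hmono (le_csSup hbdd hc.le))
  · by_contra! h
    exact ht.not_ge (le_csSup hbdd h)

theorem exists_first_eq {f : ℝ → ℝ} (hf : Continuous f) (hmono : Monotone f) {a b r : ℝ}
    (ha : f a < r) (hb : r ≤ f b) : ∃ y, f y = r ∧ ∀ t, t < y → f t < r := by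
  -- Point reflection turns the first time at level `r` into the last time at level `-r`.
  obtain ⟨x, hx, hx'⟩ := exists_last_eq (f := fun t => -f (-t)) (hf.comp continuous_neg).neg
    (fun s t hst => neg_le_neg (hmono (neg_le_neg hst))) (a := -b) (b := -a) (r := -r)
    (by simpa) (by simpa)
  refine ⟨-x, neg_inj.1 hx, fun t ht => ?_⟩
  have := hx' (-t) (lt_neg.1 ht)
  simpa using this

namespace IsPowerFunction

variable {P : ℝ → ℝ} (hP : IsPowerFunction P)
include hP

theorem measurable_comp_coe : Measurable fun s : ℝ≥0 => P s :=
  Monotone.measurable fun s t hst => hP.monotoneOn s.coe_nonneg t.coe_nonneg (by exact_mod_cast hst)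

theorem integrable_of_lintegral_ne_top {s : ℝ → ℝ≥0} (hs : Measurable s)
    (h : ∫⁻ t, ENNReal.ofReal (P (s t)) ≠ ∞) : Integrable fun t => P (s t) :=
  ⟨(hP.measurable_comp_coe.comp hs).aestronglyMeasurable, by
    rw [hasFiniteIntegral_iff_ofReal
      (Filter.Eventually.of_forall fun t => hP.nonneg (s t).coe_nonneg)]
    exact h.lt_top⟩

/-- The tangent at `1` bounds `s` by `1 + P s / P' 1`. Offline speeds may be unbounded, but finite
energy still controls their work. -/
theorem locallyIntegrable_of_integrable {s : ℝ → ℝ≥0} (hs : Measurable s)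
    (h : Integrable fun t => P (s t)) : LocallyIntegrable fun t => (s t : ℝ) := by
  have hp : 0 < deriv P 1 := by
    have h1 := hP.tangent_le one_pos le_rfl
    have h2 := hP.strictMonoOn self_mem_Ici (mem_Ici.2 zero_le_one) one_pos
    rw [hP.map_zero] at h1 h2
    linarith
  refine (((h.div_const (deriv P 1)).locallyIntegrable).add (locallyIntegrable_const 1)).mono
    hs.coe_nnreal_real.aestronglyMeasurable (Filter.Eventually.of_forall fun t => ?_)
  rw [Real.norm_of_nonneg (s t).coe_nonneg]
  refine le_trans ?_ (le_abs_self _)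
  have h1 := hP.tangent_le one_pos (s t).coe_nonneg
  have h2 := hP.nonneg zero_le_one
  have : (s t : ℝ) - 1 ≤ P (s t) / deriv P 1 := by
    rw [le_div_iff₀ hp]
    linarith
  simp only [Pi.add_apply]
  linarith

/-- Serving at least one unit of work takes the least energy at constant speed. -/
theorem unitEnergy_le {s : ℝ → ℝ≥0} (hs : LocallyIntegrable fun t => (s t : ℝ))
    (h : Integrable fun t => P (s t)) {x y : ℝ} (hxy : x < y) (h1 : 1 ≤ ∫ t in x..y, (s t : ℝ)) :
    ENNReal.ofReal (unitEnergy P (y - x)) ≤ ∫⁻ t in Ioc x y, ENNReal.ofReal (P (s t)) := by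
  rw [← ofReal_integral_eq_lintegral_ofReal h.integrableOn
    (Filter.Eventually.of_forall fun t => hP.nonneg (s t).coe_nonneg),
    ← intervalIntegral.integral_of_le hxy.le]
  refine ENNReal.ofReal_le_ofReal ?_
  have hd : 0 < y - x := sub_pos.2 hxy
  set c := (y - x)⁻¹ with hc
  have hc0 : 0 < c := inv_pos.2 hd
  have hsi := locallyIntegrable_intervalIntegrable hs x y
  -- Jensen's inequality through the tangent at the constant speed `c`; work beyond one unit only
  -- helps, as the slope is nonnegative.
  have hle := intervalIntegral.integral_mono_on hxy.le
    (f := fun t => P c + deriv P c * ((s t : ℝ) - c)) (g := fun t => P (s t))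
    (intervalIntegrable_const.add ((hsi.sub intervalIntegrable_const).const_mul _))
    h.intervalIntegrable fun t _ => hP.tangent_le hc0 (s t).coe_nonneg
  rw [intervalIntegral.integral_add intervalIntegrable_const
      ((hsi.sub intervalIntegrable_const).const_mul _), intervalIntegral.integral_const_mul,
    intervalIntegral.integral_sub hsi intervalIntegrable_const, intervalIntegral.integral_const,
    intervalIntegral.integral_const, smul_eq_mul, smul_eq_mul, hc, mul_inv_cancel₀ hd.ne'] at hle
  have := mul_nonneg (hP.deriv_nonneg hc0) (sub_nonneg.2 h1)
  simp only [unitEnergy]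
  linarith

end IsPowerFunction

namespace Schedule

variable {J m : ℕ} {σ : JobSequence J} {S : Schedule σ m} {P : ℝ → ℝ}

open scoped Classical in
/-- The work that server `k` has done on its unit jobs, not counting superfluous work. -/
noncomputable def usefulWork (S : Schedule σ m) (route : Fin J → Fin m) (k : Fin m) (t : ℝ) : ℝ :=
  ∑ j with route j = k, min (S.work j t) 1

open scoped Classical in
/-- The number of jobs that arrive before `j` and are assigned to the same server. -/
noncomputable def rank (route : Fin J → Fin m) (j : Fin J) : ℕ :=
  (Finset.univ.filter fun i => route i = route j ∧ i < j).card

theorem rank_lt_rank {route : Fin J → Fin m} {i j : Fin J} (h : route i = route j) (hij : i < j) :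
    rank route i < rank route j := by
  classical
  refine Finset.card_lt_card (Finset.ssubset_iff_of_subset ?_ |>.2 ⟨i, ?_, ?_⟩)
  · intro l hl
    simp only [Finset.mem_filter, Finset.mem_univ, true_and] at hl ⊢
    exact ⟨hl.1.trans h, hl.2.trans hij⟩
  · simp [h, hij]
  · simp

/-- A job that never completes would by itself make the flow time infinite. -/
theorem exists_one_le_work (hunit : ∀ j, σ.size j = 1)
    {j : Fin J} (hj : LocallyIntegrable fun t => (S.rate j t : ℝ))
    (h : ∫⁻ t, (S.numUnfinished t : ℝ≥0∞) ≠ ∞) : ∃ t, 1 ≤ S.work j t := by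
  classical
  by_contra! hlt
  refine h (top_le_iff.1 ?_)
  calc (∞ : ℝ≥0∞) = ∫⁻ _ in Ici (σ.arrival j), 1 := by simp
    _ ≤ ∫⁻ t in Ici (σ.arrival j), (S.numUnfinished t : ℝ≥0∞) := by
      refine setLIntegral_mono' measurableSet_Ici fun t ht => ?_
      rw [Nat.one_le_cast, Nat.one_le_iff_ne_zero]
      refine Finset.card_ne_zero.2 ⟨j, ?_⟩
      simp only [Finset.mem_filter, Finset.mem_univ, true_and]
      exact (S.unfinished_iff_of_unit hunit hj).2 ⟨ht, hlt t⟩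
    _ ≤ _ := setLIntegral_le_lintegral _ _

open scoped Classical in
theorem card_le_usefulWork (route : Fin J → Fin m) (k : Fin m) (t : ℝ) :
    ((Finset.univ.filter fun j => route j = k ∧ 1 ≤ S.work j t).card : ℝ) ≤
      S.usefulWork route k t := by
  rw [usefulWork, ← Finset.filter_filter, Finset.card_filter, Nat.cast_sum]
  refine Finset.sum_le_sum fun j _ => ?_
  split_ifs with h
  · simp [h]
  · simpa using S.work_nonneg j t

section UsefulWork

variable {route : Fin J → Fin m} (hli : ∀ j, LocallyIntegrable fun t => (S.rate j t : ℝ))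
include hli

theorem continuous_usefulWork (k : Fin m) : Continuous (S.usefulWork route k) :=
  continuous_finsetSum _ fun j _ => (continuous_work (hli j)).min continuous_const

theorem monotone_usefulWork (k : Fin m) : Monotone (S.usefulWork route k) := fun _ _ hst =>
  Finset.sum_le_sum fun j _ => min_le_min_right _ (work_mono (hli j) hst)

-- Truncation at `1` matters here: an offline schedule may go on serving a finished job.
open scoped Classical in
theorem usefulWork_le_card (k : Fin m) (t : ℝ) : S.usefulWork route k t ≤
    (Finset.univ.filter fun j => route j = k ∧ σ.arrival j ≤ t).card := by
  rw [usefulWork, ← Finset.filter_filter, Finset.card_filter, Nat.cast_sum]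
  refine Finset.sum_le_sum fun j _ => ?_
  split_ifs with h
  · simp
  · rw [work_eq_zero_of_le (hli j) (not_le.1 h).le]
    simp

/-- Truncation does not enlarge increments, and the server serves at most one job at a time. -/
theorem usefulWork_sub_le (hr : S.FollowsRoute route) {k : Fin m}
    (hs : LocallyIntegrable fun t => (S.speed k t : ℝ)) {x y : ℝ} (hxy : x ≤ y) :
    S.usefulWork route k y - S.usefulWork route k x ≤ ∫ t in x..y, (S.speed k t : ℝ) := by
  classical
  calc S.usefulWork route k y - S.usefulWork route k x
      ≤ ∑ j with route j = k, (S.work j y - S.work j x) := by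
        rw [usefulWork, usefulWork, ← Finset.sum_sub_distrib]
        refine Finset.sum_le_sum fun j _ => ?_
        have := work_mono (hli j) hxy
        rcases le_total (S.work j x) 1 with h | h
        · rw [min_eq_left h]
          linarith [min_le_left (S.work j y) 1]
        · rw [min_eq_right h]
          linarith [min_le_right (S.work j y) 1]
    _ = ∫ t in x..y, ∑ j with route j = k, (S.rate j t : ℝ) := by
        rw [intervalIntegral.integral_finsetSum fun j _ =>
          locallyIntegrable_intervalIntegrable (hli j) x y]
        exact Finset.sum_congr rfl fun j _ => work_sub (hli j) x y
    _ ≤ _ := by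
        refine intervalIntegral.integral_mono_on hxy ?_
          (locallyIntegrable_intervalIntegrable hs x y) fun t _ => ?_
        · simpa only [Finset.sum_fn] using IntervalIntegrable.sum
            (Finset.univ.filter fun j => route j = k) fun j _ =>
              locallyIntegrable_intervalIntegrable (hli j) x y
        · rw [← NNReal.coe_sum, NNReal.coe_le_coe]
          rcases hjob : S.job k t with _ | i
          · rw [Finset.sum_eq_zero fun j hj => ?_]
            · exact zero_le
            · rw [hr.rate_eq, if_neg]
              rw [(Finset.mem_filter.1 hj).2, hjob]
              simp
          · rw [Finset.sum_eq_single_of_mem i (by simp [hr k t i hjob]) fun j hj hij => ?_]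
            · exact (hr.rate_le i t).trans_eq (by rw [hr k t i hjob])
            · rw [hr.rate_eq, if_neg]
              rw [(Finset.mem_filter.1 hj).2, hjob]
              simpa using hij.symm

end UsefulWork

open scoped Classical in
/-- A non-migratory schedule of unit jobs can be replaced by one that serves the jobs of each server
one after the other in the order of their arrival, at constant speeds. -/
theorem exists_intervals (hP : IsPowerFunction P) (hunit : ∀ j, σ.size j = 1)
    {route : Fin J → Fin m} (hr : S.FollowsRoute route)
    (hn : ∫⁻ t, (S.numUnfinished t : ℝ≥0∞) ≠ ∞)
    (he : ∫⁻ t, ∑ k : Fin m, ENNReal.ofReal (P (S.speed k t)) ≠ ∞) :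
    ∃ x y : Fin J → ℝ, (∀ j, σ.arrival j ≤ x j) ∧ (∀ j, x j < y j) ∧
      (∀ i j, route i = route j → i < j → y i ≤ x j) ∧
      (∀ t, (Finset.univ.filter fun j => σ.arrival j ≤ t).card ≤
        S.numUnfinished t + (Finset.univ.filter fun j => y j ≤ t).card) ∧
      ∑ j, ENNReal.ofReal (unitEnergy P (y j - x j)) ≤
        ∫⁻ t, ∑ k : Fin m, ENNReal.ofReal (P (S.speed k t)) := by
  have hmeas : ∀ k, Measurable fun t => ENNReal.ofReal (P (S.speed k t)) := fun k =>
    (hP.measurable_comp_coe.comp (S.measurable_speed k)).ennreal_ofReal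
  have hPi : ∀ k, Integrable fun t => P (S.speed k t) := fun k =>
    hP.integrable_of_lintegral_ne_top (S.measurable_speed k) (ne_top_of_le_ne_top he
      (lintegral_mono fun t => Finset.single_le_sum
        (f := fun k => ENNReal.ofReal (P (S.speed k t))) (fun _ _ => zero_le)
        (Finset.mem_univ k)))
  have hsl : ∀ k, LocallyIntegrable fun t => (S.speed k t : ℝ) := fun k =>
    hP.locallyIntegrable_of_integrable (S.measurable_speed k) (hPi k)
  have hli : ∀ j, LocallyIntegrable fun t => (S.rate j t : ℝ) := fun j =>
    (hsl (route j)).mono (S.measurable_rate j).coe_nnreal_real.aestronglyMeasurable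
      (Filter.Eventually.of_forall fun t => by
        simpa using hr.rate_le j t)
  have hcont := fun k => continuous_usefulWork (route := route) hli k
  have hmono := fun k => monotone_usefulWork (route := route) hli k
  obtain ⟨a, ha⟩ : ∃ a, ∀ j, a < σ.arrival j := by
    obtain ⟨b, hb⟩ := (finite_range σ.arrival).bddBelow
    exact ⟨b - 1, fun j => by linarith [hb (mem_range_self j)]⟩
  have h0 : ∀ k, S.usefulWork route k a ≤ 0 := fun k => by
    refine (usefulWork_le_card hli k a).trans_eq ?_
    rw [Nat.cast_eq_zero]
    exact Finset.card_eq_zero.2 (Finset.filter_eq_empty_iff.2 fun j _ h => (ha j).not_ge h.2)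
  choose c hc using fun j => exists_one_le_work hunit (hli j) hn
  obtain ⟨b, hb⟩ := (finite_range c).bddAbove
  have hb' : ∀ j, 1 ≤ S.work j b := fun j =>
    (hc j).trans (work_mono (hli j) (hb (mem_range_self j)))
  have h1 : ∀ j, (rank route j + 1 : ℝ) ≤ S.usefulWork route (route j) b := fun j => by
    refine le_trans ?_ (card_le_usefulWork route (route j) b)
    norm_cast
    refine Finset.card_lt_card (Finset.ssubset_iff_of_subset ?_ |>.2 ⟨j, ?_, ?_⟩)
    · intro l hl
      simp only [Finset.mem_filter, Finset.mem_univ, true_and] at hl ⊢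
      exact ⟨hl.1, hb' l⟩
    · simp [hb' j]
    · simp
  -- Job `j` gets the time during which useful work rises from its rank to rank plus one. The last
  -- time at the lower level secures `arrival j ≤ x j`; the first time at the upper level makes
  -- completions as early as possible.
  choose x hx hx' using fun j => exists_last_eq (hcont (route j)) (hmono (route j))
    ((h0 (route j)).trans (Nat.cast_nonneg (rank route j)))
    ((lt_add_one (rank route j : ℝ)).trans_le (h1 j))
  choose y hy hy' using fun j => exists_first_eq (hcont (route j)) (hmono (route j))
    ((h0 (route j)).trans_lt (by positivity : (0 : ℝ) < rank route j + 1)) (h1 j)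
  have hle : ∀ j t, (rank route j + 1 : ℝ) ≤ S.usefulWork route (route j) t → y j ≤ t :=
    fun j t h => by
      by_contra! hlt
      exact (hy' j t hlt).not_ge h
  have hxy : ∀ j, x j < y j := fun j => by
    by_contra! h
    have := hmono (route j) h
    rw [hx, hy] at this
    linarith
  have hdisj : ∀ i j, route i = route j → i < j → y i ≤ x j := fun i j h hij => by
    refine hle i _ ?_
    rw [h, hx]
    exact_mod_cast rank_lt_rank h hij
  refine ⟨x, y, fun j => ?_, hxy, hdisj, fun t => ?_, ?_⟩
  -- Right after `x j` useful work exceeds the rank of `j`, so more jobs of the server have arrived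
  -- than those preceding `j`; hence `j` has arrived.
  · by_contra! h
    obtain ⟨t, ht1, ht2⟩ := exists_between h
    have h2 := (hx' j t ht1).trans_le (usefulWork_le_card hli (route j) t)
    rw [Nat.cast_lt] at h2
    refine h2.not_ge (Finset.card_le_card fun i hi => ?_)
    simp only [Finset.mem_filter, Finset.mem_univ, true_and] at hi ⊢
    refine ⟨hi.1, ?_⟩
    by_contra! hji
    exact (ht2.trans_le (σ.arrival_mono hji)).not_ge hi.2
  · have hk : ∀ k, (Finset.univ.filter fun j => route j = k ∧ 1 ≤ S.work j t).card ≤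
        (Finset.univ.filter fun j => route j = k ∧ y j ≤ t).card := fun k => by
      by_contra! hlt
      have hne : ((Finset.univ.filter fun j => route j = k) \
          (Finset.univ.filter fun j => route j = k ∧ y j ≤ t)).Nonempty := by
        rw [Finset.sdiff_nonempty]
        intro hsub
        refine hlt.not_ge (Finset.card_le_card fun j hj => hsub ?_)
        simp only [Finset.mem_filter, Finset.mem_univ, true_and] at hj ⊢
        exact hj.1
      -- For the first job `j` of the server with `t < y j`, all earlier ones have ended. If `T` had
      -- finished more jobs than that, useful work would have reached rank plus one, so `y j ≤ t`.
      obtain ⟨j, hj, hjmin⟩ := Finset.exists_min_image _ id hne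
      simp only [Finset.mem_sdiff, Finset.mem_filter, Finset.mem_univ, true_and, not_and, id] at hj hjmin
      refine hj.2 hj.1 (hle j t ?_)
      have hrank : rank route j ≤ (Finset.univ.filter fun j => route j = k ∧ y j ≤ t).card := by
        refine Finset.card_le_card fun i hi => ?_
        simp only [Finset.mem_filter, Finset.mem_univ, true_and] at hi ⊢
        refine ⟨hi.1.trans hj.1, ?_⟩
        by_contra hit
        exact hi.2.not_ge (hjmin i ⟨hi.1.trans hj.1, fun _ => hit⟩)
      rw [hj.1]
      exact le_trans (by exact_mod_cast hrank.trans_lt hlt) (card_le_usefulWork route k t)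
    have hfib : ∀ p : Fin J → Prop, (Finset.univ.filter p).card =
        ∑ k, (Finset.univ.filter fun j => route j = k ∧ p j).card := fun p => by
      rw [Finset.card_eq_sum_card_fiberwise (f := route) (t := Finset.univ) (by simp)]
      refine Finset.sum_congr rfl fun k _ => ?_
      rw [Finset.filter_filter]
      simp only [and_comm]
    have hfin : (Finset.univ.filter fun j => 1 ≤ S.work j t).card ≤
        (Finset.univ.filter fun j => y j ≤ t).card := by
      rw [hfib, hfib fun j => y j ≤ t]
      exact Finset.sum_le_sum fun k _ => hk k
    refine le_trans (le_trans (Finset.card_le_card fun j hj => ?_) (Finset.card_union_le _ _))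
      (Nat.add_le_add_left hfin _)
    simp only [Finset.mem_union, Finset.mem_filter, Finset.mem_univ, true_and] at hj ⊢
    rw [S.unfinished_iff_of_unit hunit (hli j)]
    rcases lt_or_ge (S.work j t) 1 with h | h
    · exact Or.inl ⟨hj, h⟩
    · exact Or.inr h
  · rw [lintegral_finsetSum _ fun k _ => hmeas k,
      ← Finset.sum_fiberwise_of_maps_to (g := route) (t := Finset.univ) (by simp)]
    refine Finset.sum_le_sum fun k _ => ?_
    calc ∑ j with route j = k, ENNReal.ofReal (unitEnergy P (y j - x j))
        ≤ ∑ j with route j = k, ∫⁻ t in Ioc (x j) (y j), ENNReal.ofReal (P (S.speed k t)) := by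
          refine Finset.sum_le_sum fun j hj => ?_
          have hjk := (Finset.mem_filter.1 hj).2
          refine hP.unitEnergy_le (hsl k) (hPi k) (hxy j) ?_
          have := usefulWork_sub_le hli hr (hsl k) (hxy j).le
          rw [← hjk, hx, hy] at this
          rw [← hjk]
          linarith
      _ = ∫⁻ t in ⋃ j ∈ Finset.univ.filter fun j => route j = k, Ioc (x j) (y j),
            ENNReal.ofReal (P (S.speed k t)) := by
          rw [lintegral_biUnion_finset _ (fun _ _ => measurableSet_Ioc)]
          intro i hi j hj hij
          have hrij : route i = route j := by
            rw [(Finset.mem_filter.1 hi).2, (Finset.mem_filter.1 hj).2]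
          rcases lt_or_gt_of_ne hij with h | h
          · exact (Ioc_disjoint_Ioc_of_le (hdisj i j hrij h))
          · exact (Ioc_disjoint_Ioc_of_le (hdisj j i hrij.symm h)).symm
      _ ≤ _ := setLIntegral_le_lintegral _ _

end Schedule

/-! ### Rearranging an offline schedule: round robin -/

/-- By pigeonhole, one of the first `j + 1` sorted positions holds an index at least `j`, whose
value is at least `a j`. -/
theorem le_comp_sort {J : ℕ} {a x : Fin J → ℝ} (ha : Monotone a) (hax : ∀ j, a j ≤ x j)
    (j : Fin J) : a j ≤ (x ∘ Tuple.sort x) j := by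
  obtain ⟨l, hlj, hl⟩ : ∃ l ≤ j, j ≤ Tuple.sort x l := by
    by_contra! h
    have := Finset.card_le_card_of_injOn (s := Finset.Iic j) (t := Finset.Iio j) (Tuple.sort x)
      (fun l hl => by simpa using h l (by simpa using hl)) (Tuple.sort x).injective.injOn
    simp at this
  exact (ha hl).trans ((hax _).trans (Tuple.monotone_sort x hlj))

/-- When the intervals of each of `m` servers are disjoint, the `i`-th of all ends comes before the
`(i + m)`-th of all starting times. -/
theorem sort_le_sort {J m : ℕ} {x y : Fin J → ℝ} {route : Fin J → Fin m}
    (hdisj : ∀ i j, route i = route j → i < j → y i ≤ x j) {i j : Fin J} (hij : (i : ℕ) + m ≤ j) :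
    (y ∘ Tuple.sort y) i ≤ (x ∘ Tuple.sort x) j := by
  classical
  by_contra! hlt
  -- At time `T` at least `j + 1` intervals have begun and at most `i` have ended, so more than `m`
  -- are open and two of them share a server.
  set T := (x ∘ Tuple.sort x) j with hT
  have hX : (j : ℕ) + 1 ≤ (Finset.univ.filter fun l => x l ≤ T).card := by
    have := Finset.card_le_card_of_injOn (s := Finset.Iic j)
      (t := Finset.univ.filter fun l => x l ≤ T) (Tuple.sort x)
      (fun l hl => Finset.mem_coe.2 (Finset.mem_filter.2 ⟨Finset.mem_univ _,
        Tuple.monotone_sort x (by simpa using hl : l ≤ j)⟩))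
      (Tuple.sort x).injective.injOn
    simpa using this
  have hY : (Finset.univ.filter fun l => y l ≤ T).card ≤ i := by
    have := Finset.card_le_card_of_injOn (s := Finset.univ.filter fun l => y l ≤ T)
      (t := Finset.Iio i) (Tuple.sort y).symm
      (fun l hl => by
        simp only [Finset.coe_filter, Finset.mem_univ, true_and, mem_ofPred_eq] at hl
        simp only [Finset.coe_Iio, mem_Iio]
        by_contra! h
        have := Tuple.monotone_sort y h
        simp only [Function.comp_apply, Equiv.apply_symm_apply] at this hlt
        linarith)
      (Tuple.sort y).symm.injective.injOn
    simpa using this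
  have hB : m < ((Finset.univ.filter fun l => x l ≤ T) \
      (Finset.univ.filter fun l => y l ≤ T)).card := by
    have := Finset.le_card_sdiff (Finset.univ.filter fun l => y l ≤ T)
      (Finset.univ.filter fun l => x l ≤ T)
    omega
  obtain ⟨k, hk, l, hl, hkl, hr⟩ := Finset.exists_ne_map_eq_of_card_lt_of_maps_to
    (t := Finset.univ) (by simpa using hB) (f := route) (fun _ _ => Finset.mem_coe.2 (Finset.mem_univ _))
  simp only [Finset.mem_sdiff, Finset.mem_filter, Finset.mem_univ, true_and, not_le] at hk hl
  rcases lt_or_gt_of_ne hkl with h | h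
  · have := hdisj k l hr h
    linarith
  · have := hdisj l k hr.symm h
    linarith

/-- Disjoint intervals on each of `m` servers can be rearranged into round robin order, without
changing the ends as a multiset, and without increasing the energy. -/
theorem exists_roundRobin_intervals {P : ℝ → ℝ} (hP : IsPowerFunction P) {J m : ℕ}
    {a x y : Fin J → ℝ} {route : Fin J → Fin m} (ha : Monotone a) (hax : ∀ j, a j ≤ x j)
    (hxy : ∀ j, x j < y j) (hdisj : ∀ i j, route i = route j → i < j → y i ≤ x j) :
    ∃ x' y' : Fin J → ℝ, (∀ j, a j ≤ x' j) ∧ (∀ j, x' j < y' j) ∧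
      (∀ i j : Fin J, (i : ℕ) + m ≤ j → y' i ≤ x' j) ∧ (∃ τ : Equiv.Perm (Fin J), y' = y ∘ τ) ∧
      ∑ j, unitEnergy P (y' j - x' j) ≤ ∑ j, unitEnergy P (y j - x j) := by
  obtain ⟨h1, h2⟩ := sum_sub_sort_le hP.convexOn_unitEnergy (Tuple.monotone_sort x)
    (y := y ∘ Tuple.sort x) fun j => hxy _
  have e := Tuple.comp_perm_comp_sort_eq_comp_sort (f := y) (σ := Tuple.sort x)
  rw [e] at h1 h2
  refine ⟨x ∘ Tuple.sort x, y ∘ Tuple.sort y, le_comp_sort ha hax, h1,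
    fun i j hij => sort_le_sort hdisj hij, ⟨_, rfl⟩, h2.trans_eq ?_⟩
  exact Equiv.sum_comp (Tuple.sort x) fun j => unitEnergy P (y j - x j)

/-! ### Existence of a run of the policy -/

/-- Completion times under first come first served, when the jobs of a server are `m` apart and
`next n b` is the completion time of job `n` if its service starts at time `b`. -/
noncomputable def completionTime (next : ℕ → ℝ → ℝ) (a : ℕ → ℝ) (m n : ℕ) : ℝ :=
  if 0 < m ∧ m ≤ n then next n (max (a n) (completionTime next a m (n - m))) else next n (a n)
termination_by n
decreasing_by omega

theorem exists_start_completion (next : ℕ → ℝ → ℝ) (a : ℕ → ℝ) {m : ℕ} (hm : 0 < m) :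
    ∃ b c : ℕ → ℝ, (∀ n, c n = next n (b n)) ∧ (∀ n, n < m → b n = a n) ∧
      ∀ n, b (n + m) = max (a (n + m)) (c n) := by
  refine ⟨fun n => if 0 < m ∧ m ≤ n then max (a n) (completionTime next a m (n - m)) else a n,
    completionTime next a m, fun n => ?_, fun n hn => ?_, fun n => ?_⟩
  · rw [completionTime]
    split_ifs with h <;> simp [h]
  · simp [hn]
  · simp [hm]

section Construction

variable {P : ℝ → ℝ} {J : ℕ}

open scoped Classical in
/-- The number of jobs from job `n` on that are on the server of job `n` and arrive up to time
`t`. -/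
noncomputable def numBehind (a : Fin J → ℝ) (m n : ℕ) (t : ℝ) : ℕ :=
  (Finset.univ.filter fun i : Fin J => (i : ℕ) % m = n % m ∧ n ≤ i ∧ a i ≤ t).card

theorem monotone_numBehind (a : Fin J → ℝ) (m n : ℕ) : Monotone (numBehind a m n) :=
  fun s t hst => Finset.card_le_card fun i hi => by
    simp only [Finset.mem_filter, Finset.mem_univ, true_and] at hi ⊢
    exact ⟨hi.1, hi.2.1, hi.2.2.trans hst⟩

theorem one_le_numBehind {a : Fin J → ℝ} (m : ℕ) {n : Fin J} {t : ℝ} (h : a n ≤ t) :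
    1 ≤ numBehind a m n t :=
  Finset.card_pos.2 ⟨n, by simpa using h⟩

theorem monotone_powerInv_numBehind (hP : IsPowerFunction P) (a : Fin J → ℝ) (m n : ℕ) :
    Monotone fun t => powerInv P (numBehind a m n t) := fun _ _ hst =>
  hP.powerInv_mono (Nat.cast_nonneg _) (Nat.cast_le.2 (monotone_numBehind a m n hst))

theorem mul_le_integral_powerInv (hP : IsPowerFunction P) {a : Fin J → ℝ} (m : ℕ) {n : Fin J}
    {s t : ℝ} (hs : a n ≤ s) (hst : s ≤ t) :
    (t - s) * powerInv P 1 ≤ ∫ u in s..t, powerInv P (numBehind a m n u) := by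
  have := intervalIntegral.integral_mono_on hst (f := fun _ => powerInv P 1)
    (μ := volume) intervalIntegrable_const
    (monotone_powerInv_numBehind hP a m n).intervalIntegrable fun u hu =>
      hP.powerInv_mono zero_le_one (by exact_mod_cast one_le_numBehind m (hs.trans hu.1))
  simpa using this

/-- While job `n` is in service under first come first served, the unfinished jobs of its server are
exactly those counted by `numBehind`. The speed is thus known in advance, and is at least `powerInv
P 1`, so one unit is completed in bounded time. -/
theorem exists_integral_powerInv_eq_one (hP : IsPowerFunction P) {a : Fin J → ℝ} (m : ℕ)
    {n : Fin J} {b : ℝ} (hb : a n ≤ b) :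
    ∃ c, b < c ∧ ∫ u in b..c, powerInv P (numBehind a m n u) = 1 := by
  have hg : 0 < powerInv P 1 := hP.powerInv_pos one_pos
  have hbc : b ≤ b + (powerInv P 1)⁻¹ := by linarith [inv_pos.2 hg]
  have hcont : Continuous fun c => ∫ u in b..c, powerInv P (numBehind a m n u) :=
    intervalIntegral.continuous_primitive
      (fun _ _ => (monotone_powerInv_numBehind hP a m n).intervalIntegrable) _
  obtain ⟨c, hc, hc1⟩ := intermediate_value_Icc hbc hcont.continuousOn
    (show (1 : ℝ) ∈ Icc _ _ by
      refine ⟨by simp, le_trans ?_ (mul_le_integral_powerInv hP m hb hbc)⟩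
      rw [add_sub_cancel_left, inv_mul_cancel₀ hg.ne'])
  refine ⟨c, hc.1.lt_of_ne ?_, hc1⟩
  rintro rfl
  simp at hc1

/-- Starting and completion times under round robin dispatch with first come first served. -/
theorem exists_service_intervals (hP : IsPowerFunction P) {a : Fin J → ℝ} {m : ℕ} (hm : 0 < m) :
    ∃ b c : Fin J → ℝ, (∀ j, a j ≤ b j) ∧ (∀ j, b j < c j) ∧
      (∀ i j : Fin J, (i : ℕ) % m = j % m → i < j → c i ≤ b j) ∧
      (∀ (j : Fin J) (t : ℝ), a j ≤ t → (∀ i : Fin J, (i : ℕ) % m = j % m → i < j → c i ≤ t) →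
        b j ≤ t) ∧
      ∀ j : Fin J, ∫ u in b j..c j, powerInv P (numBehind a m j u) = 1 := by
  classical
  choose next hnext using fun (n : Fin J) (b : ℝ) =>
    (by
      by_cases h : a n ≤ b
      · obtain ⟨c, hc⟩ := exists_integral_powerInv_eq_one hP m h
        exact ⟨c, fun _ => hc⟩
      · exact ⟨0, fun h' => absurd h' h⟩ :
      ∃ c, a n ≤ b → b < c ∧ ∫ u in b..c, powerInv P (numBehind a m n u) = 1)
  obtain ⟨b, c, hc, hb0, hb⟩ := exists_start_completion
    (fun n b => if h : n < J then next ⟨n, h⟩ b else 0)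
    (fun n => if h : n < J then a ⟨n, h⟩ else 0) hm
  have hab : ∀ j : Fin J, a j ≤ b j := fun j => by
    rcases lt_or_ge (j : ℕ) m with h | h
    · rw [hb0 _ h, dif_pos j.2]
    · obtain ⟨n, hn⟩ := Nat.exists_eq_add_of_le' h
      have := hb n
      rw [← hn, dif_pos j.2] at this
      rw [this]
      exact le_max_left _ _
  have hc' : ∀ j : Fin J, c j = next j (b j) := fun j => by rw [hc, dif_pos j.2]
  have hbc : ∀ j : Fin J, b j < c j := fun j => by
    rw [hc']
    exact (hnext j (b j) (hab j)).1
  have hchain : ∀ n q : ℕ, n + (q + 1) * m < J → c n ≤ b (n + (q + 1) * m) := fun n q => by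
    induction q with
    | zero =>
      intro _
      rw [zero_add, one_mul, hb]
      exact le_max_right _ _
    | succ q ih =>
      intro h
      have e : n + (q + 1 + 1) * m = n + (q + 1) * m + m := by ring
      have h' : n + (q + 1) * m < J := by omega
      rw [e, hb]
      exact ((ih h').trans (hbc ⟨_, h'⟩).le).trans (le_max_right _ _)
  refine ⟨fun j => b j, fun j => c j, hab, hbc, fun i j hij hlt => ?_, fun j t hat h => ?_,
    fun j => ?_⟩
  · obtain ⟨q, hq⟩ := (Nat.modEq_iff_dvd' (Fin.lt_def.1 hlt).le).1 hij
    have hlt' := Fin.lt_def.1 hlt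
    obtain ⟨q, rfl⟩ : ∃ q', q = q' + 1 := Nat.exists_eq_succ_of_ne_zero (by
      rintro rfl
      omega)
    have e : (j : ℕ) = i + (q + 1) * m := by
      rw [mul_comm]
      omega
    have := hchain i q (e ▸ j.2)
    rwa [← e] at this
  · rcases lt_or_ge (j : ℕ) m with hj | hj
    · simp only [hb0 _ hj, j.2, dif_pos]
      exact hat
    · obtain ⟨n, hn⟩ := Nat.exists_eq_add_of_le' hj
      have hnJ : n < J := by have := j.2; omega
      have := hb n
      rw [← hn, dif_pos j.2] at this
      refine this.trans_le (max_le hat (h ⟨n, hnJ⟩ ?_ ?_))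
      · simp [hn]
      · rw [Fin.lt_def]
        simp only
        omega
  · simp only [hc']
    exact (hnext j (b j) (hab j)).2

end Construction

open Schedule in
open scoped Classical in
/-- The policy can be run, for instance with first come first served on each server. -/
theorem exists_isRoundRobinPolicy {P : ℝ → ℝ} (hP : IsPowerFunction P) {m : ℕ} (hm : 0 < m) {J : ℕ}
    (σ : JobSequence J) (hunit : ∀ j, σ.size j = 1) :
    ∃ S : Schedule σ m, S.IsRoundRobinPolicy P := by
  obtain ⟨b, c, hab, hbc, hcb, hstart, hint⟩ :=
    exists_service_intervals hP (a := σ.arrival) hm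
  set route : Fin J → Fin m := fun j => ⟨j % m, Nat.mod_lt _ hm⟩ with hroute
  have hroute_iff : ∀ i j, route i = route j ↔ (i : ℕ) % m = j % m := fun i j => by
    simp [hroute]
  set num : Fin m → ℝ → ℕ := fun k t =>
    (Finset.univ.filter fun j => route j = k ∧ σ.arrival j ≤ t ∧ t < c j).card with hnum
  have hnum_meas : ∀ k, Measurable (num k) := fun k => by
    have : num k = fun t => ∑ j, if route j = k ∧ σ.arrival j ≤ t ∧ t < c j then 1 else 0 := by
      funext t
      simp only [hnum, Finset.card_filter]
    rw [this]
    refine Finset.measurable_sum _ fun j _ => Measurable.ite ?_ measurable_const measurable_const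
    exact (MeasurableSet.const _).inter (measurableSet_Ici.inter measurableSet_Iio)
  set job : Fin m → ℝ → Option (Fin J) := fun k t =>
    if h : ∃ j, route j = k ∧ b j ≤ t ∧ t < c j then some h.choose else none with hjob
  have hjob_iff : ∀ k t j, job k t = some j ↔ route j = k ∧ b j ≤ t ∧ t < c j := fun k t j => by
    constructor
    · intro h
      simp only [hjob] at h
      split_ifs at h with hex
      rw [← Option.some.inj h]
      exact hex.choose_spec
    · intro h
      have hex : ∃ j, route j = k ∧ b j ≤ t ∧ t < c j := ⟨j, h⟩
      simp only [hjob, dif_pos hex, Option.some.injEq]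
      have h' := hex.choose_spec
      have hr := (hroute_iff _ _).1 (h'.1.trans h.1.symm)
      rcases lt_trichotomy hex.choose j with hlt | heq | hlt
      · exact absurd ((hcb _ _ hr hlt).trans h.2.1) h'.2.2.not_ge
      · exact heq
      · exact absurd ((hcb _ _ hr.symm hlt).trans h'.2.1) h.2.2.not_ge
  let S : Schedule σ m :=
    { speed := fun k t => ⟨powerInv P (num k t), hP.powerInv_nonneg (Nat.cast_nonneg _)⟩
      job := job
      measurable_speed := fun k => Measurable.subtype_mk
        ((measurable_from_nat (f := fun n : ℕ => powerInv P n)).comp (hnum_meas k))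
      measurableSet_job := fun k j => by
        simp only [hjob_iff]
        exact (MeasurableSet.const _).inter (measurableSet_Ici.inter measurableSet_Iio)
      arrival_le := fun k t j h => (hab j).trans ((hjob_iff k t j).1 h).2.1
      no_splitting := fun k k' t j h h' =>
        ((hjob_iff k t j).1 h).1.symm.trans ((hjob_iff k' t j).1 h').1 }
  have hr : S.FollowsRoute route := fun k t j h => ((hjob_iff k t j).1 h).1
  have hrate0 : ∀ j t, ¬(b j ≤ t ∧ t < c j) → S.rate j t = 0 := fun j t h => by
    rw [hr.rate_eq, if_neg fun h' => h ((hjob_iff _ _ _).1 h').2]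
  have hrate : ∀ j t, b j ≤ t → t < c j →
      (S.rate j t : ℝ) = powerInv P (numBehind σ.arrival m j t) := fun j t h1 h2 => by
    rw [hr.rate_eq, if_pos ((hjob_iff _ _ _).2 ⟨rfl, h1, h2⟩)]
    change powerInv P (num (route j) t) = _
    congr 2
    simp only [hnum, numBehind]
    congr 1
    refine Finset.filter_congr fun i _ => ?_
    rw [hroute_iff]
    refine and_congr_right fun hij => ?_
    rcases lt_trichotomy i j with h | h | h
    · simp only [not_le.2 h, Fin.val_fin_le, false_and, iff_false, not_and, not_lt]
      exact fun _ => (hcb i j hij h).trans h1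
    · subst h
      simp [h2]
    · simp only [h.le, Fin.val_fin_le, true_and, and_iff_left_iff_imp]
      exact fun _ => (h2.trans_le (hcb j i hij.symm h)).trans (hbc i)
  have hli : ∀ j, LocallyIntegrable fun t => (S.rate j t : ℝ) := fun j =>
    locallyIntegrable_of_le (S.measurable_rate j) (M := powerInv P J) fun t =>
      (NNReal.coe_le_coe.2 (hr.rate_le j t)).trans (hP.powerInv_mono (Nat.cast_nonneg _)
        (Nat.cast_le.2 ((Finset.card_filter_le _ _).trans (by simp))))
  have hwork0 : ∀ j t, t ≤ b j → S.work j t = 0 := fun j t h => by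
    rw [← work_eq_of_rate_eq_zero (hli j) (min_le_left t (σ.arrival j))
      fun u hu => hrate0 j u fun h' => (hu.2.trans_le h).not_ge h'.1]
    exact work_eq_zero_of_le (hli j) (min_le_right _ _)
  have hwork_sub : ∀ j s, b j ≤ s → s ≤ c j → S.work j (c j) - S.work j s =
      ∫ u in s..c j, powerInv P (numBehind σ.arrival m j u) := fun j s h1 h2 => by
    rw [work_sub (hli j), intervalIntegral.integral_of_le h2, intervalIntegral.integral_of_le h2,
      integral_Ioc_eq_integral_Ioo, integral_Ioc_eq_integral_Ioo]
    exact setIntegral_congr_fun measurableSet_Ioo fun u hu =>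
      hrate j u (h1.trans hu.1.le) hu.2
  have hworkc : ∀ j, S.work j (c j) = 1 := fun j => by
    have := hwork_sub j (b j) le_rfl (hbc j).le
    rwa [hint, hwork0 j _ le_rfl, sub_zero] at this
  have hlt : ∀ j t, S.work j t < 1 ↔ t < c j := fun j t => by
    constructor
    · intro h
      by_contra! hct
      exact h.not_ge ((hworkc j).ge.trans (work_mono (hli j) hct))
    · intro h
      rcases le_total t (b j) with hb | hb
      · rw [hwork0 j t hb]
        exact one_pos
      · have h1 := hwork_sub j t hb h.le
        have h2 := mul_le_integral_powerInv hP m ((hab j).trans hb) h.le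
        have h3 := mul_pos (sub_pos.2 h) (hP.powerInv_pos one_pos)
        rw [hworkc] at h1
        linarith
  have hunf : ∀ j t, S.Unfinished j t ↔ σ.arrival j ≤ t ∧ t < c j := fun j t => by
    rw [S.unfinished_iff_of_unit hunit (hli j), hlt]
  have hnumU : ∀ k t, S.numUnfinishedAt route k t = num k t := fun k t => by
    simp only [numUnfinishedAt, hnum, hunf]
  refine ⟨S, route, fun j => rfl, fun k t => ⟨fun j h => ?_, fun h => ?_⟩, fun k t => ?_⟩
  · obtain ⟨hjk, h1, h2⟩ := (hjob_iff k t j).1 h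
    refine ⟨hjk, (hunf j t).2 ⟨(hab j).trans h1, h2⟩, fun i hik hi => ?_⟩
    have hij := (hroute_iff i j).1 (hik.trans hjk.symm)
    rcases lt_trichotomy i j with hlt' | rfl | hlt'
    · exact absurd ((hcb i j hij hlt').trans h1) ((hunf i t).1 hi).2.not_ge
    · rfl
    -- A later job of the server has not been started, so its remaining size is the full size.
    · have h0 := hwork0 i t (h2.le.trans (hcb j i hij.symm hlt'))
      have h0' : S.workDone i t = 0 :=
        ((ENNReal.toReal_eq_zero_iff _).1 h0).resolve_right (workDone_ne_top (hli i) t)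
      simp only [remaining, hunit, h0', tsub_zero]
      exact tsub_le_self
  · rw [hnumU]
    by_contra hne
    have hex : (Finset.univ.filter fun j => route j = k ∧ σ.arrival j ≤ t ∧ t < c j).Nonempty :=
      Finset.card_ne_zero.1 hne
    obtain ⟨j, hj, hmin⟩ := Finset.exists_min_image _ id hex
    -- The earliest unfinished job of the server has arrived and all its predecessors there are
    -- complete, so by `hstart` it is in service.
    simp only [Finset.mem_filter, Finset.mem_univ, true_and, id] at hj hmin
    have hbt : b j ≤ t := hstart j t hj.2.1 fun i hij hlt' => by
      by_contra! hti
      exact hlt'.not_ge (hmin i ⟨((hroute_iff i j).2 hij).trans hj.1,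
        (σ.arrival_mono hlt'.le).trans hj.2.1, hti⟩)
    have := (hjob_iff k t j).2 ⟨hj.1, hbt, hj.2.2⟩
    have h' : job k t = none := h
    rw [this] at h'
    exact Option.some_ne_none _ h'
  · rw [hnumU]
    rfl

/-! ### The competitive ratio -/

namespace Schedule

variable {J m : ℕ} {σ : JobSequence J} {S T : Schedule σ m} {P : ℝ → ℝ}

/-- The policy spends as much energy as flow time. -/
theorem cost_eq_of_policy (hP : IsPowerFunction P) {route : Fin J → Fin m}
    (hspeed : ∀ k t, (S.speed k t : ℝ) = powerInv P (S.numUnfinishedAt route k t)) :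
    S.cost P = 2 * ∑ k, ∫⁻ t, (S.numUnfinishedAt route k t : ℝ≥0∞) := by
  have hpower : ∀ k t, ENNReal.ofReal (P (S.speed k t)) = S.numUnfinishedAt route k t :=
    fun k t => by
      rw [hspeed, hP.map_powerInv (Nat.cast_nonneg _), ENNReal.ofReal_natCast]
  have hmeas : ∀ k, Measurable fun t => (S.numUnfinishedAt route k t : ℝ≥0∞) := fun k =>
    measurable_from_nat.comp (S.measurable_numUnfinishedAt route k)
  simp_rw [cost, hpower, ← S.sum_numUnfinishedAt route, Nat.cast_sum]
  rw [lintegral_finsetSum _ fun k _ => hmeas k, two_mul]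

/-- The policy costs at most twice as much as any non-migratory schedule. -/
theorem IsRoundRobinPolicy.cost_le (hP : IsPowerFunction P) (hunit : ∀ j, σ.size j = 1)
    (hS : S.IsRoundRobinPolicy P) (hT : T.IsNonMigratory) : S.cost P ≤ 2 * T.cost P := by
  classical
  rcases eq_or_ne (T.cost P) ∞ with h | h
  · rw [h, ENNReal.mul_top two_ne_zero]
    exact le_top
  obtain ⟨route, hrr, hsrpt, hspeed⟩ := hS
  obtain ⟨routeT, hrT⟩ := hT
  rw [cost, ENNReal.add_ne_top] at h
  obtain ⟨x, y, hax, hxy, hdisj, hflow, henergy⟩ := exists_intervals hP hunit hrT h.1 h.2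
  obtain ⟨x', y', hax', hxy', hdisj', ⟨τ, hτ⟩, henergy'⟩ :=
    exists_roundRobin_intervals hP σ.arrival_mono hax hxy hdisj
  have hdisj'' : ∀ i j, route i = route j → i < j → y' i ≤ x' j := fun i j hij hlt => by
    refine hdisj' i j ?_
    have h1 : (i : ℕ) % m = j % m := by rw [← hrr, ← hrr, hij]
    have h2 := Fin.lt_def.1 hlt
    -- Distinct jobs on one round robin server have labels at least `m` apart.
    have h3 := Nat.le_of_dvd (by omega) ((Nat.modEq_iff_dvd' h2.le).1 h1)
    omega
  have hcard : ∀ t, (Finset.univ.filter fun j => y' j ≤ t).card =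
      (Finset.univ.filter fun j => y j ≤ t).card := fun t => by
    rw [Finset.card_filter, Finset.card_filter, hτ]
    exact Equiv.sum_comp τ fun j => if y j ≤ t then 1 else 0
  have hflow' : ∀ t, ∑ k, (Finset.univ.filter fun j =>
      route j = k ∧ σ.arrival j ≤ t ∧ t < y' j).card ≤ T.numUnfinished t := fun t => by
    have e : ∑ k, (Finset.univ.filter fun j => route j = k ∧ σ.arrival j ≤ t ∧ t < y' j).card =
        (Finset.univ.filter fun j => σ.arrival j ≤ t ∧ t < y' j).card := by
      rw [Finset.card_eq_sum_card_fiberwise (f := route) (t := Finset.univ) (by simp)]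
      refine Finset.sum_congr rfl fun k _ => ?_
      rw [Finset.filter_filter]
      simp only [and_comm]
    -- Unfinished jobs are arrivals minus completions. Permuting the ends keeps the number of
    -- completions, so the flow bound for `y` carries over to `y'`.
    have h1 : (Finset.univ.filter fun j => σ.arrival j ≤ t ∧ t < y' j).card +
        (Finset.univ.filter fun j => y' j ≤ t).card ≤
          (Finset.univ.filter fun j => σ.arrival j ≤ t).card := by
      rw [← Finset.card_union_of_disjoint]
      · refine Finset.card_le_card fun j hj => ?_
        simp only [Finset.mem_union, Finset.mem_filter, Finset.mem_univ, true_and] at hj ⊢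
        exact hj.elim And.left fun h => (hax' j).trans ((hxy' j).le.trans h)
      · rw [Finset.disjoint_filter]
        exact fun j _ h1 h2 => h1.2.not_ge h2
    have h2 := hflow t
    rw [← hcard] at h2
    omega
  have hnonneg : ∀ u v : Fin J → ℝ, (∀ j, u j < v j) →
      ∀ j ∈ Finset.univ, 0 ≤ unitEnergy P (v j - u j) := fun u v huv j _ =>
    mul_nonneg (sub_nonneg.2 (huv j).le) (hP.nonneg (inv_nonneg.2 (sub_nonneg.2 (huv j).le)))
  rw [cost_eq_of_policy hP hspeed]
  gcongr
  calc ∑ k, ∫⁻ t, (S.numUnfinishedAt route k t : ℝ≥0∞)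
      ≤ ∑ k, ((∫⁻ t, ((Finset.univ.filter fun j =>
          route j = k ∧ σ.arrival j ≤ t ∧ t < y' j).card : ℝ≥0∞)) +
        ∑ j with route j = k, ENNReal.ofReal (unitEnergy P (y' j - x' j))) :=
        Finset.sum_le_sum fun k _ =>
          lintegral_numUnfinishedAt_le hP hunit hsrpt hspeed hax' hxy' hdisj'' k
    _ = (∑ k, ∫⁻ t, ((Finset.univ.filter fun j =>
          route j = k ∧ σ.arrival j ≤ t ∧ t < y' j).card : ℝ≥0∞)) +
        ENNReal.ofReal (∑ j, unitEnergy P (y' j - x' j)) := by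
        rw [Finset.sum_add_distrib, ENNReal.ofReal_sum_of_nonneg (hnonneg x' y' hxy'),
          Finset.sum_fiberwise_of_maps_to (by simp)]
    _ ≤ _ := by
        refine add_le_add ?_ ?_
        · rw [← lintegral_finsetSum]
          · exact lintegral_mono fun t => by
              simp only
              exact_mod_cast hflow' t
          · intro k _
            simp_rw [Finset.card_filter, Nat.cast_sum]
            refine Finset.measurable_sum _ fun j _ => measurable_from_nat.comp
              (Measurable.ite ?_ measurable_const measurable_const)
            exact (MeasurableSet.const _).inter (measurableSet_Ici.inter measurableSet_Iio)
        · refine (ENNReal.ofReal_le_ofReal henergy').trans ?_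
          rw [ENNReal.ofReal_sum_of_nonneg (hnonneg x y hxy)]
          exact henergy

end Schedule

end SpeedScaling

theorem mainTheorem3 (P : ℝ → ℝ) (hP : SpeedScaling.IsPowerFunction P) (m : ℕ) (hm : 0 < m)
    (J : ℕ) (σ : SpeedScaling.JobSequence J) (hunit : ∀ j, σ.size j = 1) :
    (∃ S : SpeedScaling.Schedule σ m, S.IsRoundRobinPolicy P) ∧
      ∀ S : SpeedScaling.Schedule σ m, S.IsRoundRobinPolicy P →
        S.cost P ≤ 2 * SpeedScaling.optCost P σ m := by
  refine ⟨SpeedScaling.exists_isRoundRobinPolicy hP hm σ hunit, fun S hS => ?_⟩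
  simp only [SpeedScaling.optCost, ENNReal.mul_iInf_of_ne two_ne_zero ENNReal.ofNat_ne_top]
  exact le_iInf₂ fun T hT => hS.cost_le hP hunit hT
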